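/- Let $M,N\ge 1$ be integers with $\gcd(M,N)=1$, and suppose that $X_0(M)$ has genus zero. Let $t$ be a Hauptmodul of $X_0(M)$, normalised so that it is holomorphic on $X_0(M)\setminus\{\infty\}$ and has a simple pole at $\infty$ with leading coefficient $1$, i.e. $t(\tau)=q^{-1}+O(1)$, $q=e^{2\pi\sqrt{-1}\,\tau}$. For an elliptic curve $E$ over $\mathbb C$ and a cyclic subgroup $C\subset E$ of order $M$, put $t(E,C)=t(\tau)$ if $(E,C)\cong\bigl(\mathbb C/(\mathbb Z+\mathbb Z\tau),\langle \tfrac1M\rangle\bigr)$. Let $P_N(E,C)$ be the set of classes $[f,E_1,C_1]$ of cyclic isogenies $f\colon E_1\to E$ of degree $N$ together with a cyclic subgroup $C_1\subset E_1$ of order $M$ such that $f(C_1)=C$; here $(f_1,E_1,C_1)\cong(f_2,E_2,C_2)$ if there is an isomorphism $g\colon E_1\to E_2$ with $f_1=f_2\circ g$ and $g(C_1)=C_2$. Then there is a unique polynomial $\Psi_N^{\Gamma_0(M)}(X,Y)\in\mathbb C[X,Y]$ such that $$\Psi_N^{\Gamma_0(M)}\bigl(t(E,C),t(E',C')\bigr)=\prod_{[f,E_1',C_1']\in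 P_N(E',C')}\bigl(t(E,C)-t(E_1',C_1')\bigr)$$ for all $(E,C)$ and $(E',C')$, and $\Psi_N^{\Gamma_0(M)}(X,t)$ is irreducible as a polynomial in $X$ over the field $\mathbb C(t)$. -/

import Mathlib

open scoped MatrixGroups Manifold UpperHalfPlane Polynomial

noncomputable section

namespace CyclicModular

/-! ### Elliptic curves over `ℂ`, isogenies, level structures -/

/-- An elliptic curve over `ℂ`, in its analytic form `E = ℂ / Λ` with `Λ` a lattice in `ℂ`. -/
structure EllCurve where
  lattice : Submodule ℤ ℂ
  isLattice : ∃ L : PeriodPair, L.lattice = lattice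

/-- The group of points `ℂ / Λ`. -/
abbrev EllCurve.Points (E : EllCurve) : Type := ℂ ⧸ E.lattice

/-- The projection `ℂ → ℂ / Λ`. -/
abbrev EllCurve.proj (E : EllCurve) (z : ℂ) : E.Points := Submodule.Quotient.mk z

/-- An isogeny `ℂ / Λ₁ → ℂ / Λ₂`: a group homomorphism induced by multiplication by a nonzero
complex number. -/
structure Isogeny (E₁ E₂ : EllCurve) where
  hom : E₁.Points →+ E₂.Points
  exists_mul : ∃ α : ℂ, α ≠ 0 ∧ ∀ z : ℂ, hom (E₁.proj z) = E₂.proj (α * z)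

namespace Isogeny

variable {E₁ E₂ E₃ : EllCurve}

/-- The degree of an isogeny: the order of its kernel. -/
def degree (f : Isogeny E₁ E₂) : ℕ := Nat.card f.hom.ker

/-- A cyclic isogeny: the kernel is a cyclic group. -/
def IsCyclic (f : Isogeny E₁ E₂) : Prop := IsAddCyclic f.hom.ker

/-- An isomorphism: a bijective isogeny. -/
def IsIso (f : Isogeny E₁ E₂) : Prop := Function.Bijective f.hom

/-- The identity isogeny. -/
def id (E : EllCurve) : Isogeny E E where
  hom := AddMonoidHom.id _
  exists_mul := ⟨1, one_ne_zero, fun z => by simp⟩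

/-- Composition `g ∘ f` of isogenies. -/
def comp (g : Isogeny E₂ E₃) (f : Isogeny E₁ E₂) : Isogeny E₁ E₃ where
  hom := g.hom.comp f.hom
  exists_mul := by
    obtain ⟨a, ha, hf⟩ := f.exists_mul
    obtain ⟨b, hb, hg⟩ := g.exists_mul
    refine ⟨b * a, mul_ne_zero hb ha, fun z => ?_⟩
    rw [AddMonoidHom.comp_apply, hf, hg, mul_assoc]

/-- The inverse of an isomorphism. -/
def inv (f : Isogeny E₁ E₂) (hf : f.IsIso) : Isogeny E₂ E₁ where
  hom := (AddEquiv.ofBijective f.hom hf).symm.toAddMonoidHom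
  exists_mul := by
    obtain ⟨a, ha, h⟩ := f.exists_mul
    refine ⟨a⁻¹, inv_ne_zero ha, fun z => ?_⟩
    change (AddEquiv.ofBijective f.hom hf).symm _ = _
    rw [AddEquiv.symm_apply_eq]
    change _ = f.hom _
    rw [h, mul_inv_cancel_left₀ ha]

theorem inv_comp (f : Isogeny E₁ E₂) (hf : f.IsIso) :
    (f.inv hf).hom.comp f.hom = AddMonoidHom.id _ := by
  ext x
  exact (AddEquiv.ofBijective f.hom hf).symm_apply_apply x

theorem comp_inv (f : Isogeny E₁ E₂) (hf : f.IsIso) :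
    f.hom.comp (f.inv hf).hom = AddMonoidHom.id _ := by
  ext x
  exact (AddEquiv.ofBijective f.hom hf).apply_symm_apply x

theorem isIso_inv (f : Isogeny E₁ E₂) (hf : f.IsIso) : (f.inv hf).IsIso :=
  (AddEquiv.ofBijective f.hom hf).symm.bijective

end Isogeny

/-- An elliptic curve with level structure for `Γ₀(M)`: a pair `(E, C)` with `C` a cyclic subgroup
of `E` of order `M`. -/
structure LevelCurve (M : ℕ) where
  E : EllCurve
  C : AddSubgroup E.Points
  cyclic : IsAddCyclic C
  card : Nat.card C = M

/-- Isomorphism of elliptic curves with level structure. -/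
def LevelCurve.Iso {M : ℕ} (X Y : LevelCurve M) : Prop :=
  ∃ g : Isogeny X.E Y.E, g.IsIso ∧ X.C.map g.hom = Y.C

theorem LevelCurve.Iso.symm {M : ℕ} {X Y : LevelCurve M} : X.Iso Y → Y.Iso X := by
  rintro ⟨g, hg, h⟩
  refine ⟨g.inv hg, g.isIso_inv hg, ?_⟩
  rw [← h, AddSubgroup.map_map, g.inv_comp hg, AddSubgroup.map_id]

theorem LevelCurve.Iso.trans {M : ℕ} {X Y Z : LevelCurve M} :
    X.Iso Y → Y.Iso Z → X.Iso Z := by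
  rintro ⟨g, hg, h⟩ ⟨g', hg', h'⟩
  refine ⟨g'.comp g, hg'.comp hg, ?_⟩
  rw [← h', ← h, AddSubgroup.map_map]
  rfl

/-! ### The curves `(E_τ, ⟨1/M⟩)` and the value of a modular function at `(E, C)` -/

/-- The basis `τ, 1` of the lattice `Λ_τ = ℤ + ℤ τ`. -/
def tauPair (τ : ℍ) : PeriodPair where
  ω₁ := τ
  ω₂ := 1
  indep := by
    rw [LinearIndependent.pair_iff]
    intro s r h
    have him := congrArg Complex.im h
    have hre := congrArg Complex.re h
    have hs : s = 0 := by
      have := τ.im_pos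
      simp at him
      rcases him with h | h
      · exact h
      · exact absurd h τ.im_ne_zero
    subst hs
    simpa using hre

/-- `E_τ = ℂ / (ℤ + ℤ τ)`. -/
def tauCurve (τ : ℍ) : EllCurve := ⟨(tauPair τ).lattice, _, rfl⟩

theorem addOrderOf_inv (M : ℕ) [NeZero M] (τ : ℍ) :
    addOrderOf ((tauCurve τ).proj (1 / M : ℂ)) = M := by
  have hM : (M : ℂ) ≠ 0 := Nat.cast_ne_zero.mpr (NeZero.ne M)
  have key : ∀ k : ℕ, k • ((tauCurve τ).proj (1 / M : ℂ)) = 0 ↔ M ∣ k := by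
    intro k
    rw [← Submodule.Quotient.mk_smul, Submodule.Quotient.mk_eq_zero]
    change _ ∈ (tauPair τ).lattice ↔ _
    have e : k • (1 / M : ℂ) = ((0 : ℚ) : ℂ) * (tauPair τ).ω₁
        + (((k : ℚ) / (M : ℚ) : ℚ) : ℂ) * (tauPair τ).ω₂ := by
      simp [tauPair, div_eq_mul_inv]
    rw [e, PeriodPair.mul_ω₁_add_mul_ω₂_mem_lattice]
    simp only [Rat.den_zero, true_and]
    have := Rat.den_div_natCast_eq_one_iff k M (NeZero.ne M)
    simpa using this
  refine Nat.dvd_antisymm ?_ ?_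
  · exact addOrderOf_dvd_of_nsmul_eq_zero ((key M).2 dvd_rfl)
  · exact (key _).1 (addOrderOf_nsmul_eq_zero _)

/-- The pair `(E_τ, ⟨1/M + Λ_τ⟩)`, which represents the point `Γ₀(M) τ` of `Y₀(M)`. -/
def tauLevel (M : ℕ) [NeZero M] (τ : ℍ) : LevelCurve M where
  E := tauCurve τ
  C := AddSubgroup.zmultiples ((tauCurve τ).proj (1 / M : ℂ))
  cyclic := inferInstance
  card := by rw [Nat.card_zmultiples, addOrderOf_inv]

open Classical in
/-- The value `t(E, C)` of a function `t` on the upper half plane: `t(E, C) = t(τ)` if `(E, C)` is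
isomorphic to `(E_τ, ⟨1/M⟩)`. Every `(E, C)` is isomorphic to such a pair, and if `t` is
`Γ₀(M)`-invariant, the value does not depend on the choice of `τ`. -/
def value (M : ℕ) [NeZero M] (t : ℍ → ℂ) (X : LevelCurve M) : ℂ :=
  if h : {τ : ℍ | X.Iso (tauLevel M τ)}.Nonempty then t h.some else 0

theorem value_eq_of_iso {M : ℕ} [NeZero M] (t : ℍ → ℂ) {X Y : LevelCurve M} (h : X.Iso Y) :
    value M t X = value M t Y := by
  have : {τ : ℍ | X.Iso (tauLevel M τ)} = {τ : ℍ | Y.Iso (tauLevel M τ)} := by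
    ext τ
    exact ⟨fun h' => h.symm.trans h', fun h' => h.trans h'⟩
  unfold value
  split_ifs with h₁ h₂ h₂
  · congr 2
  · exact absurd (this ▸ h₁) h₂
  · exact absurd (this ▸ h₂) h₁
  · rfl

/-! ### Equivalence classes of cyclic isogenies -/

/-- A triple `(f, E₁, C₁)`, where `f : E₁ → E` is a cyclic isogeny of degree `N` with
`f(C₁) = C`. -/
structure CycIsog (M N : ℕ) (X : LevelCurve M) where
  source : LevelCurve M
  f : Isogeny source.E X.E
  degree_eq : f.degree = N
  cyclic : f.IsCyclic
  map_C : source.C.map f.hom = X.C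

/-- `(f₁, E₁, C₁) ≅ (f₂, E₂, C₂)` if there is `g : E₁ → E₂` with `f₁ = f₂ ∘ g` and `g(C₁) = C₂`.
As `f₁` and `f₂` have the same degree, such an isogeny `g` is an isomorphism. -/
instance cycIsogSetoid (M N : ℕ) (X : LevelCurve M) : Setoid (CycIsog M N X) where
  r φ ψ := ∃ g : Isogeny φ.source.E ψ.source.E,
    g.IsIso ∧ φ.f.hom = ψ.f.hom.comp g.hom ∧ φ.source.C.map g.hom = ψ.source.C
  iseqv :=
    { refl := fun φ => ⟨Isogeny.id _, Function.bijective_id, rfl, AddSubgroup.map_id _⟩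
      symm := by
        rintro φ ψ ⟨g, hg, hf, hC⟩
        refine ⟨g.inv hg, g.isIso_inv hg, ?_, ?_⟩
        · rw [hf, AddMonoidHom.comp_assoc, g.comp_inv hg, AddMonoidHom.comp_id]
        · rw [← hC, AddSubgroup.map_map, g.inv_comp hg, AddSubgroup.map_id]
      trans := by
        rintro φ ψ χ ⟨g, hg, hf, hC⟩ ⟨g', hg', hf', hC'⟩
        refine ⟨g'.comp g, hg'.comp hg, ?_, ?_⟩
        · rw [hf, hf', AddMonoidHom.comp_assoc]
          rfl
        · rw [← hC', ← hC, AddSubgroup.map_map]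
          rfl }

/-- The set `P_N(E, C)` of equivalence classes `[f, E₁, C₁]` of cyclic isogenies of degree `N`. -/
def CycIsogClass (M N : ℕ) (X : LevelCurve M) : Type := Quotient (cycIsogSetoid M N X)

/-- The value `t(E₁, C₁)` at a class `[f, E₁, C₁]`. -/
def sourceValue (M N : ℕ) [NeZero M] (t : ℍ → ℂ) (X : LevelCurve M) :
    CycIsogClass M N X → ℂ :=
  Quotient.lift (fun φ => value M t φ.source)
    (fun _ _ ⟨g, hg, _, hC⟩ => value_eq_of_iso t ⟨g, hg, hC⟩)

/-! ### Hauptmoduln and the cyclic modular polynomial -/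

/-- `t` is a Hauptmodul of `X₀(M)`, normalised as follows: it is a function on `Y₀(M)`, holomorphic
on `X₀(M) ∖ {∞}`, with a simple pole at `∞` whose leading coefficient is `1`, that is,
`t = q⁻¹ + O(1)` with `q = exp(2 π i τ)`. -/
structure IsHauptmodul (M : ℕ) (t : ℍ → ℂ) : Prop where
  holo : MDiff t
  invariant : ∀ γ ∈ CongruenceSubgroup.Gamma0 M, ∀ τ : ℍ, t (γ • τ) = t τ
  simple_pole : Filter.Tendsto (fun τ : ℍ => Function.Periodic.qParam 1 τ * t τ)
    UpperHalfPlane.atImInfty (nhds 1)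
  /-- Holomorphy at the other cusps: the cusp `γ ∞` with `γ ∈ SL₂(ℤ)` is equivalent to `∞` under
  `Γ₀(M)` if and only if `γ ∈ Γ₀(M)`. -/
  bounded : ∀ γ : SL(2, ℤ), γ ∉ CongruenceSubgroup.Gamma0 M →
    UpperHalfPlane.IsBoundedAtImInfty (fun τ : ℍ => t (γ • τ))

/-- `Ψ ∈ ℂ[X, Y]`, written as a polynomial in `X` with coefficients in `ℂ[Y]`, is the cyclic modular
polynomial of level `N` for `Γ₀(M)` and `t`: for all `(E, C)` and `(E', C')`,
`Ψ(t(E, C), t(E', C')) = ∏ (t(E, C) - t(E₁', C₁'))`, over the classes `[f, E₁', C₁']` of cyclic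
isogenies `f : E₁' → E'` of degree `N` with `f(C₁') = C'`. -/
def IsCyclicModularPolynomial (M N : ℕ) [NeZero M] (t : ℍ → ℂ) (Ψ : ℂ[X][X]) : Prop :=
  ∀ X X' : LevelCurve M,
    Ψ.evalEval (value M t X') (value M t X) =
      ∏ᶠ c : CycIsogClass M N X', (value M t X - sourceValue M N t X' c)

end CyclicModular

end

/-!
The proof makes the right-hand side explicit and then argues as for the classical modular equation.

Every `(E, C)` is isomorphic to a pair `(E_τ, ⟨1/M⟩)` (`LevelCurve.exists_iso_tauLevel`), and `τ` is
unique up to `Γ₀(M)` (`exists_smul_eq_of_iso`), so `t(E, C)` is the value `t τ`. A cyclic isogeny of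
degree `N` to `E_τ` is, up to equivalence, given by a sublattice of `ℤ τ + ℤ` with cyclic quotient
of order `N`, and such a sublattice has a unique basis `a τ + b, d` in Hermite normal form:
`a d = N`, `0 ≤ b < d`, `gcd (a, b, d) = 1`. As `M` is prime to `N`, the subgroup `C₁` is determined by
`C` and corresponds to `⟨1/M⟩` on `E_{(aτ + b)/d}`. Hence the product over `P_N` is the finite product
`∏ (X - t((a τ + b)/d))` over the Hermite forms (`finprod_sourceValue`).

*Existence.* The coefficients of this product are `Γ₀(M)`-invariant, because right multiplication by
`Γ₀(M)` permutes the classes of Hermite forms. They are holomorphic on the upper half plane, have at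
most a pole at `∞`, and are bounded at the other cusps, because the cusps `γ ∞` with `γ ∉ Γ₀(M)` are
preserved by matrices of determinant prime to `M`. Subtracting multiples of powers of `t` reduces
such a function to one bounded at all cusps, that is, to a constant; so it is a polynomial in `t`
(`IsHauptmodul.exists_aeval_eq`). *Uniqueness* holds since `t` takes infinitely many values.

*Irreducibility.* The polynomial is monic in `X`, so by the lemma of Gauss it suffices to exclude
monic factorizations over `ℂ[Y]`. In a factorization, one of the factors vanishes identically at
`X = t(N τ)`, `Y = t(τ)`, by the identity theorem. As `Γ₀(M)` acts transitively on the Hermite forms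
(`HermiteForm.exists_diag_mul`), this factor vanishes at all `X = t((a τ + b)/d)`. These functions
are pairwise distinct, by the leading terms `exp (-2 π i (a τ + b)/d)` of their expansions
(`IsHauptmodul.eq_of_comp_pt_eq`), so the factor has full degree
(`IsHauptmodul.card_le_natDegree`).
-/

noncomputable section

namespace CyclicModular

/-! ### Hermite normal forms of primitive integral matrices -/

/-- If `a`, `b`, `d` generate the unit ideal and `a ≠ 0`, then some element of the residue class of
`b` modulo `d` is prime to `a`. -/
theorem exists_isCoprime_add_mul {a b d : ℤ} (ha : a ≠ 0)
    (h : ∃ x y z : ℤ, a * x + b * y + d * z = 1) : ∃ k : ℤ, IsCoprime (b + k * d) a := by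
  obtain ⟨x, y, z, h⟩ := h
  have : NeZero a.natAbs := ⟨Int.natAbs_ne_zero.mpr ha⟩
  have hg : Int.gcd d a ∣ a.natAbs := Int.gcd_dvd_natAbs_right d a
  obtain ⟨da, hda⟩ := Int.gcd_dvd_right d a
  obtain ⟨dd, hdd⟩ := Int.gcd_dvd_left d a
  have hb : IsUnit (b : ZMod (Int.gcd d a)) := by
    refine (ZMod.coe_int_isUnit_iff_isCoprime b _).mpr ⟨da * x + dd * z, y, ?_⟩
    linear_combination h - x * hda - z * hdd
  -- A unit modulo `gcd d a` lifts to a unit modulo `a`.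
  obtain ⟨v, hv⟩ := ZMod.unitsMap_surjective hg hb.unit
  obtain ⟨w, hw⟩ := ZMod.intCast_surjective (v : ZMod a.natAbs)
  have hwb : ((w : ℤ) : ZMod (Int.gcd d a)) = b := by
    have := congrArg Units.val hv
    rw [ZMod.unitsMap_val, ← hw, ZMod.cast_intCast hg] at this
    simpa using this
  have hwa : IsCoprime w a := by
    have : IsUnit ((w : ℤ) : ZMod a.natAbs) := hw ▸ v.isUnit
    have := (ZMod.coe_int_isUnit_iff_isCoprime w _).mp this
    rw [isCoprime_comm]
    rcases Int.natAbs_eq a with h | h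
    · rwa [h]
    · rw [h]; exact this.neg_left
  obtain ⟨m, hm⟩ := (ZMod.intCast_eq_intCast_iff_dvd_sub b w _).mp hwb.symm
  have hgcd := Int.gcd_eq_gcd_ab d a
  refine ⟨Int.gcdA d a * m, ?_⟩
  have e : b + Int.gcdA d a * m * d = w + a * (-(Int.gcdB d a * m)) := by
    linear_combination -hm - m * hgcd
  rw [e]
  exact IsCoprime.add_mul_left_left hwa _

/-- The matrices `(a, b; 0, d)` in Hermite normal form which are integral, primitive and of
determinant `N`; they represent the classes of primitive integral matrices of determinant `N` modulo
left multiplication by `SL₂(ℤ)`. Primitivity is expressed by a Bézout relation. -/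
@[ext]
structure HermiteForm (N : ℕ) where
  a : ℤ
  b : ℤ
  d : ℤ
  a_pos : 0 < a
  d_pos : 0 < d
  b_nonneg : 0 ≤ b
  b_lt : b < d
  mul_eq : a * d = N
  primitive : ∃ x y z : ℤ, a * x + b * y + d * z = 1

namespace HermiteForm

variable {N : ℕ}

theorem a_le (s : HermiteForm N) : s.a ≤ N := by
  nlinarith [s.mul_eq, s.a_pos, s.d_pos]

theorem d_le (s : HermiteForm N) : s.d ≤ N := by
  nlinarith [s.mul_eq, s.a_pos, s.d_pos]

instance : Finite (HermiteForm N) := by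
  let F : HermiteForm N → Set.Icc (0 : ℤ) N × Set.Icc (0 : ℤ) N × Set.Icc (0 : ℤ) N :=
    fun s => (⟨s.a, s.a_pos.le, s.a_le⟩, ⟨s.b, s.b_nonneg, s.b_lt.le.trans s.d_le⟩,
      ⟨s.d, s.d_pos.le, s.d_le⟩)
  refine Finite.of_injective F fun s s' h => ?_
  simp only [F, Prod.mk.injEq] at h
  exact HermiteForm.ext (congrArg Subtype.val h.1) (congrArg Subtype.val h.2.1)
    (congrArg Subtype.val h.2.2)

instance : Fintype (HermiteForm N) := Fintype.ofFinite _

instance : DecidableEq (HermiteForm N) := Classical.decEq _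

/-- The diagonal matrix `(N, 0; 0, 1)`. -/
def diag (N : ℕ) (hN : 0 < N) : HermiteForm N where
  a := N
  b := 0
  d := 1
  a_pos := by exact_mod_cast hN
  d_pos := one_pos
  b_nonneg := le_rfl
  b_lt := one_pos
  mul_eq := by ring
  primitive := ⟨0, 0, 1, by ring⟩

theorem isCoprime_a {M : ℕ} (hMN : Nat.Coprime M N) (s : HermiteForm N) :
    IsCoprime s.a (M : ℤ) := by
  have : IsCoprime (M : ℤ) (s.a * s.d) := by
    rw [s.mul_eq]; exact Nat.isCoprime_iff_coprime.mpr hMN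
  exact this.of_mul_right_left.symm

theorem isCoprime_d {M : ℕ} (hMN : Nat.Coprime M N) (s : HermiteForm N) :
    IsCoprime s.d (M : ℤ) := by
  have : IsCoprime (M : ℤ) (s.a * s.d) := by
    rw [s.mul_eq]; exact Nat.isCoprime_iff_coprime.mpr hMN
  exact this.of_mul_right_right.symm

/-- The underlying matrix. -/
def mat (s : HermiteForm N) : Matrix (Fin 2) (Fin 2) ℤ := !![s.a, s.b; 0, s.d]

/-- Reduction to Hermite normal form: a primitive integral matrix of determinant `N` has the form
`γ * s` with `γ ∈ SL₂(ℤ)`. -/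
theorem exists_eq_mul_mat (hN : 0 < N) (A B C D : ℤ) (hdet : A * D - B * C = N)
    (hprim : ∃ x y z w : ℤ, A * x + B * y + C * z + D * w = 1) :
    ∃ (γ : SL(2, ℤ)) (s : HermiteForm N),
      !![A, B; C, D] = (γ : Matrix (Fin 2) (Fin 2) ℤ) * s.mat := by
  have hN' : (0 : ℤ) < N := by exact_mod_cast hN
  have hg0 : Int.gcd A C ≠ 0 := by
    intro h
    obtain ⟨h1, h2⟩ := Int.gcd_eq_zero_iff.mp h
    rw [h1, h2] at hdet
    linarith
  have hg : (0 : ℤ) < Int.gcd A C := by exact_mod_cast Nat.pos_of_ne_zero hg0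
  obtain ⟨A', hA⟩ := Int.gcd_dvd_left A C
  obtain ⟨C', hC⟩ := Int.gcd_dvd_right A C
  have hgcd := Int.gcd_eq_gcd_ab A C
  generalize Int.gcdA A C = u at hgcd
  generalize Int.gcdB A C = v at hgcd
  generalize (Int.gcd A C : ℤ) = g at *
  subst hA hC
  have huv : A' * u + C' * v = 1 := by
    apply mul_left_cancel₀ hg.ne'
    linear_combination -hgcd
  have hd : g * (A' * D - C' * B) = N := by rw [← hdet]; ring
  have hdpos : 0 < A' * D - C' * B := pos_of_mul_pos_right (hd ▸ hN') hg.le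
  set d := A' * D - C' * B with hddef
  have hmod := Int.emod_add_mul_ediv (u * B + v * D) d
  set b := (u * B + v * D) % d with hb
  set n := (u * B + v * D) / d with hn
  obtain ⟨x, y, z, w, hp⟩ := hprim
  have eB : B = A' * b + (n * A' - v) * d := by
    linear_combination (-B) * huv - A' * hmod + v * hddef
  have eD : D = C' * b + (n * C' + u) * d := by
    linear_combination (-D) * huv - C' * hmod - u * hddef
  refine ⟨⟨!![A', n * A' - v; C', n * C' + u], ?_⟩,
    ⟨g, b, d, hg, hdpos, Int.emod_nonneg _ hdpos.ne', Int.emod_lt_of_pos _ hdpos, hd,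
      A' * x + C' * z, A' * y + C' * w, (n * A' - v) * y + (n * C' + u) * w, ?_⟩, ?_⟩
  · rw [Matrix.det_fin_two_of]
    linear_combination huv
  · linear_combination hp - y * eB - w * eD
  · ext i j
    fin_cases i <;> fin_cases j <;> simp [mat, Matrix.mul_apply, Fin.sum_univ_two]
    · ring
    · exact eB
    · ring
    · exact eD

/-- A matrix in Hermite normal form is determined by its class modulo `SL₂(ℤ)`. -/
theorem eq_of_mat_eq_mul (s s' : HermiteForm N) (γ : SL(2, ℤ))
    (h : s.mat = (γ : Matrix (Fin 2) (Fin 2) ℤ) * s'.mat) : s = s' := by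
  have h00 := congrFun (congrFun h 0) 0
  have h01 := congrFun (congrFun h 0) 1
  have h10 := congrFun (congrFun h 1) 0
  have h11 := congrFun (congrFun h 1) 1
  simp [mat, Matrix.mul_apply, Fin.sum_univ_two] at h00 h01 h10 h11
  have hdet := γ.det_coe
  rw [Matrix.det_fin_two] at hdet
  have h0 : γ 1 0 = 0 := h10.resolve_right s'.a_pos.ne'
  rw [h0] at hdet h11
  have hγ : 0 < γ 0 0 := by
    have := s.a_pos
    rw [h00] at this
    exact pos_of_mul_pos_left this s'.a_pos.le
  have h1 : γ 0 0 = 1 := Int.eq_one_of_mul_eq_one_right hγ.le (b := γ 1 1) (by linarith)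
  have h2 : γ 1 1 = 1 := by rw [h1] at hdet; linarith
  rw [h1] at h00 h01
  rw [h2] at h11
  have ed : s.d = s'.d := by linarith
  have eb : s.b = s'.b := by
    rw [← Int.emod_eq_of_lt s.b_nonneg s.b_lt, ← Int.emod_eq_of_lt s'.b_nonneg s'.b_lt, h01, ed]
    simp
  exact HermiteForm.ext (by linarith) eb ed

/-- Right multiplication by `SL₂(ℤ)` on the classes of primitive matrices. -/
theorem exists_mat_mul (hN : 0 < N) (s : HermiteForm N) (γ : SL(2, ℤ)) :
    ∃ (γ' : SL(2, ℤ)) (s' : HermiteForm N),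
      s.mat * (γ : Matrix (Fin 2) (Fin 2) ℤ) = (γ' : Matrix (Fin 2) (Fin 2) ℤ) * s'.mat := by
  have hdet := γ.det_coe
  rw [Matrix.det_fin_two] at hdet
  obtain ⟨x, y, z, h⟩ := s.primitive
  obtain ⟨γ', s', h'⟩ := exists_eq_mul_mat hN (s.a * γ 0 0 + s.b * γ 1 0)
    (s.a * γ 0 1 + s.b * γ 1 1) (s.d * γ 1 0) (s.d * γ 1 1)
    (by rw [← s.mul_eq]; linear_combination s.a * s.d * hdet)
    ⟨x * γ 1 1 - y * γ 0 1, -x * γ 1 0 + y * γ 0 0, - γ 0 1 * z, γ 0 0 * z,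
      by linear_combination h + (s.a * x + s.b * y + s.d * z) * hdet⟩
  refine ⟨γ', s', h' ▸ ?_⟩
  ext i j
  fin_cases i <;> fin_cases j <;> simp [mat, Matrix.mul_apply, Fin.sum_univ_two]

/-- When `M` is prime to `N`, the relation `s * γ = γ' * s'` preserves membership in `Γ₀(M)`. -/
theorem mem_Gamma0_iff {M : ℕ} (hMN : Nat.Coprime M N) {s s' : HermiteForm N} {γ γ' : SL(2, ℤ)}
    (h : s.mat * (γ : Matrix (Fin 2) (Fin 2) ℤ) = (γ' : Matrix (Fin 2) (Fin 2) ℤ) * s'.mat) :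
    γ ∈ CongruenceSubgroup.Gamma0 M ↔ γ' ∈ CongruenceSubgroup.Gamma0 M := by
  have h10 := congrFun (congrFun h 1) 0
  simp [mat, Matrix.mul_apply, Fin.sum_univ_two] at h10
  rw [CongruenceSubgroup.Gamma0_mem, CongruenceSubgroup.Gamma0_mem,
    ZMod.intCast_zmod_eq_zero_iff_dvd, ZMod.intCast_zmod_eq_zero_iff_dvd]
  constructor <;> intro hd
  · exact (s'.isCoprime_a hMN).symm.dvd_of_dvd_mul_right (h10 ▸ hd.mul_left _)
  · exact (s.isCoprime_d hMN).symm.dvd_of_dvd_mul_left (h10 ▸ hd.mul_right _)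

/-- The matrix `diag(N, 1)` is moved to any given class by right multiplication by `Γ₀(M)`, if `M`
is prime to `N`. -/
theorem exists_diag_mul {M : ℕ} (hN : 0 < N) (hMN : Nat.Coprime M N) (s : HermiteForm N) :
    ∃ γ ∈ CongruenceSubgroup.Gamma0 M, ∃ γ' ∈ CongruenceSubgroup.Gamma0 M,
      (diag N hN).mat * (γ : Matrix (Fin 2) (Fin 2) ℤ)
        = (γ' : Matrix (Fin 2) (Fin 2) ℤ) * s.mat := by
  obtain ⟨x, y, z, hp⟩ := s.primitive
  obtain ⟨k, hk⟩ := exists_isCoprime_add_mul (a := s.d) (b := s.b) (d := s.a) s.d_pos.ne'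
    ⟨z, y, x, by linear_combination hp⟩
  -- `γ'` has first row `(d, -(b + k a))` and lower left entry divisible by `M`.
  obtain ⟨u, v, huv⟩ : IsCoprime s.d ((s.b + k * s.a) * M) :=
    (hk.symm).mul_right (s.isCoprime_d hMN)
  have hmul := s.mul_eq
  let γ' : SL(2, ℤ) := ⟨!![s.d, -(s.b + k * s.a); v * M, u], by
    rw [Matrix.det_fin_two_of]; linear_combination huv⟩
  let γ : SL(2, ℤ) := ⟨!![1, -k; v * M * s.a, v * M * s.b + u * s.d], by
    rw [Matrix.det_fin_two_of]; linear_combination huv⟩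
  refine ⟨γ, ?_, γ', ?_, ?_⟩
  · rw [CongruenceSubgroup.Gamma0_mem]; simp [γ]
  · rw [CongruenceSubgroup.Gamma0_mem]; simp [γ']
  · ext i j
    fin_cases i <;> fin_cases j <;> simp [mat, Matrix.mul_apply, Fin.sum_univ_two, γ, γ', diag]
    · linear_combination -hmul
    · linear_combination k * hmul

/-- A cyclic quotient of order `N` of `ℤ²` is the quotient by the row lattice of a matrix in
Hermite normal form. -/
theorem exists_dvd_iff (hN : 0 < N) (A B : ℤ)
    (hprim : ∃ x y z : ℤ, A * x + B * y + N * z = 1) :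
    ∃ s : HermiteForm N, ∀ u v : ℤ, (N : ℤ) ∣ A * u + B * v ↔
      ∃ m n : ℤ, u = m * s.a ∧ v = m * s.b + n * s.d := by
  have hN' : (0 : ℤ) < N := by exact_mod_cast hN
  obtain ⟨x, y, z, hp⟩ := hprim
  have hg0 : Int.gcd B N ≠ 0 := by
    intro h
    exact hN'.ne' (Int.gcd_eq_zero_iff.mp h).2
  have hg : (0 : ℤ) < Int.gcd B N := by exact_mod_cast Nat.pos_of_ne_zero hg0
  obtain ⟨B', hB⟩ := Int.gcd_dvd_left B N
  obtain ⟨d, hd⟩ := Int.gcd_dvd_right B N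
  have hgcd := Int.gcd_eq_gcd_ab B N
  generalize Int.gcdA B N = e at hgcd
  generalize Int.gcdB B N = f at hgcd
  generalize (Int.gcd B N : ℤ) = a at *
  have hef : B' * e + d * f = 1 := by
    apply mul_left_cancel₀ hg.ne'
    linear_combination -hgcd - e * hB - f * hd
  have hdpos : 0 < d := pos_of_mul_pos_right (hd ▸ hN') hg.le
  have hAa : A * x + a * (B' * y + d * z) = 1 := by
    linear_combination hp - y * hB - z * hd
  -- `(a, b)` lies in the lattice for `b ≡ -A e`, since `B' e ≡ 1` modulo `d`.
  have hmod := Int.emod_add_mul_ediv (-A * e) d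
  set b := (-A * e) % d with hb
  set n := (-A * e) / d with hn
  have hAb : A + B' * b = d * (A * f - B' * n) := by
    linear_combination (-A) * hef + B' * hmod
  refine ⟨⟨a, b, d, hg, hdpos, Int.emod_nonneg _ hdpos.ne', Int.emod_lt_of_pos _ hdpos, hd.symm,
    B' * y + d * z, -B' * x, (A * f - B' * n) * x, ?_⟩, fun u v => ⟨?_, ?_⟩⟩
  · linear_combination hAa - x * hAb
  · rintro ⟨c, hc⟩
    have hau : a ∣ u := by
      have h1 : a ∣ A * u := ⟨d * c - B' * v, by linear_combination hc + c * hd - v * hB⟩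
      exact IsCoprime.dvd_of_dvd_mul_left ⟨B' * y + d * z, x, by linear_combination hAa⟩ h1
    obtain ⟨m, rfl⟩ := hau
    have hdv : d ∣ v - m * b := by
      have h1 : d ∣ B' * (v - m * b) := by
        refine ⟨c - m * (A * f - B' * n), ?_⟩
        apply mul_left_cancel₀ hg.ne'
        linear_combination hc + c * hd - v * hB - a * m * hAb
      exact IsCoprime.dvd_of_dvd_mul_left ⟨f, e, by linear_combination hef⟩ h1
    obtain ⟨k, hk⟩ := hdv
    exact ⟨m, k, by ring, by linear_combination hk⟩
  · rintro ⟨m, k, rfl, rfl⟩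
    exact ⟨m * (A * f - B' * n) + B' * k, by
      linear_combination (m * b + k * d) * hB + a * m * hAb - (m * (A * f - B' * n) + B' * k) * hd⟩

/-- The row lattice of a matrix in Hermite normal form is the kernel of a surjection `ℤ² → ℤ/N`. -/
theorem exists_linear_form (s : HermiteForm N) :
    ∃ A B x y : ℤ, A * x + B * y = 1 ∧ ∀ u v : ℤ, (N : ℤ) ∣ A * u + B * v ↔
      ∃ m n : ℤ, u = m * s.a ∧ v = m * s.b + n * s.d := by
  obtain ⟨k, e, f, hef⟩ := exists_isCoprime_add_mul (a := s.a) (b := s.b) (d := s.d) s.a_pos.ne'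
    s.primitive
  have hmul := s.mul_eq
  refine ⟨-(s.b + k * s.d), s.a, -e, f, by linear_combination hef, fun u v => ⟨?_, ?_⟩⟩
  · rintro ⟨c, hc⟩
    have hau : s.a ∣ u := by
      have h1 : s.a ∣ (s.b + k * s.d) * u := ⟨v - s.d * c, by linear_combination -hc + c * hmul⟩
      exact IsCoprime.dvd_of_dvd_mul_left ⟨f, e, by linear_combination hef⟩ h1
    obtain ⟨m, rfl⟩ := hau
    refine ⟨m, m * k + c, by ring, ?_⟩
    apply mul_left_cancel₀ s.a_pos.ne'
    linear_combination hc - c * hmul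
  · rintro ⟨m, n, rfl, rfl⟩
    exact ⟨n - m * k, by linear_combination (n - m * k) * hmul⟩

end HermiteForm

/-! ### The action of Hermite forms on the upper half plane -/

section Analysis

open UpperHalfPlane Filter Topology Function.Periodic

namespace HermiteForm

variable {N : ℕ}

/-- The matrix `(a, b; 0, d)` as an element of `GL₂(ℝ)`. -/
def toGL (s : HermiteForm N) : GL (Fin 2) ℝ :=
  Matrix.GeneralLinearGroup.mkOfDetNeZero (s.mat.map (Int.cast : ℤ → ℝ)) (by
    simp [mat, Matrix.det_fin_two, s.a_pos.ne', s.d_pos.ne'])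

/-- The point `(a τ + b) / d` of the upper half plane. -/
def pt (s : HermiteForm N) (τ : ℍ) : ℍ := s.toGL • τ

theorem det_toGL_pos (s : HermiteForm N) : 0 < s.toGL.det.val := by
  have h : s.toGL.det.val = s.a * s.d := by
    simp [toGL, mat, Matrix.det_fin_two, Matrix.GeneralLinearGroup.mkOfDetNeZero]
  rw [h]
  exact mul_pos (by exact_mod_cast s.a_pos) (by exact_mod_cast s.d_pos)

theorem coe_pt (s : HermiteForm N) (τ : ℍ) : (s.pt τ : ℂ) = (s.a * τ + s.b) / s.d := by
  rw [pt, coe_smul_of_det_pos s.det_toGL_pos]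
  simp [num, denom, toGL, mat, Matrix.GeneralLinearGroup.mkOfDetNeZero]

theorem im_pt (s : HermiteForm N) (τ : ℍ) : (s.pt τ).im = s.a / s.d * τ.im := by
  have e : (s.pt τ : ℂ) = ((s.a / s.d : ℝ) : ℂ) * τ + ((s.b / s.d : ℝ) : ℂ) := by
    rw [coe_pt]
    push_cast
    ring
  rw [← coe_im, e, Complex.add_im, Complex.im_ofReal_mul]
  simp

theorem pt_smul {s s' : HermiteForm N} {γ γ' : SL(2, ℤ)}
    (h : s.mat * (γ : Matrix (Fin 2) (Fin 2) ℤ) = (γ' : Matrix (Fin 2) (Fin 2) ℤ) * s'.mat)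
    (τ : ℍ) : s.pt (γ • τ) = γ' • s'.pt τ := by
  rw [pt, pt, ModularGroup.sl_moeb, ModularGroup.sl_moeb, ← mul_smul, ← mul_smul]
  congr 1
  apply Units.ext
  have := congrArg (fun A : Matrix (Fin 2) (Fin 2) ℤ => A.map (Int.cast : ℤ → ℝ)) h
  simp only [Matrix.map_mul_intCast] at this
  exact this

theorem mdifferentiable_comp_pt {t : ℍ → ℂ} (ht : MDiff t) (s : HermiteForm N) :
    MDiff (fun τ => t (s.pt τ)) :=
  ht.comp (mdifferentiable_smul s.det_toGL_pos)

theorem tendsto_pt (s : HermiteForm N) : Tendsto s.pt atImInfty atImInfty :=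
  tendsto_smul_atImInfty (by simp [toGL, mat, Matrix.GeneralLinearGroup.mkOfDetNeZero])

end HermiteForm

/-! ### Weakly holomorphic functions on `X₀(M)` -/

local notation "𝕢" => Function.Periodic.qParam 1

theorem isBoundedAtImInfty_qParam_pow (k : ℕ) :
    IsBoundedAtImInfty (fun τ : ℍ => 𝕢 τ ^ k) :=
  Subalgebra.pow_mem (boundedAtImInftySubalgebra ℂ)
    (IsZeroAtImInfty.isBoundedAtImInfty (qParam_tendsto_atImInfty one_pos)) k

theorem periodic_comp_ofComplex_of_vadd {f : ℍ → ℂ} (hf : ∀ τ, f ((1 : ℝ) +ᵥ τ) = f τ) :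
    Function.Periodic (f ∘ ofComplex) ((1 : ℝ) : ℂ) := by
  intro w
  by_cases! hw : 0 < w.im
  · have : 0 < (w + (1 : ℝ)).im := by simp [hw]
    simp only [Function.comp_apply, ofComplex_apply_of_im_pos this, ofComplex_apply_of_im_pos hw]
    convert! hf ⟨w, hw⟩ using 2
    ext
    simp [add_comm]
  · have : (w + (1 : ℝ)).im ≤ 0 := by simpa using hw
    rw [Function.comp_apply, Function.comp_apply, ofComplex_apply_of_im_nonpos this,
      ofComplex_apply_of_im_nonpos hw]

theorem apply_vadd_of_invariant {M : ℕ} {f : ℍ → ℂ}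
    (hf : ∀ γ ∈ CongruenceSubgroup.Gamma0 M, ∀ τ : ℍ, f (γ • τ) = f τ) (τ : ℍ) :
    f ((1 : ℝ) +ᵥ τ) = f τ := by
  rw [← modular_T_smul]
  exact hf _ (by rw [CongruenceSubgroup.Gamma0_mem]; simp [ModularGroup.T]) τ

theorem mdifferentiable_qParam_pow (k : ℕ) : MDiff (fun τ : ℍ => 𝕢 τ ^ k) := by
  have h : Differentiable ℂ (fun z : ℂ => 𝕢 z ^ k) := differentiable_qParam.pow k
  exact h.mdifferentiable.comp mdifferentiable_coe

theorem qParam_vadd_one (τ : ℍ) : 𝕢 (((1 : ℝ) +ᵥ τ : ℍ) : ℂ) = 𝕢 τ := by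
  rw [coe_vadd, qParam, qParam, ← Complex.exp_periodic (2 * Real.pi * Complex.I * τ / (1 : ℝ))]
  congr 1
  push_cast
  ring

/-- A holomorphic function on `Y₀(M)` which is bounded at all cusps is constant. -/
theorem exists_eq_const {M : ℕ} [NeZero M] {f : ℍ → ℂ} (hf : MDiff f)
    (hinv : ∀ γ ∈ CongruenceSubgroup.Gamma0 M, ∀ τ : ℍ, f (γ • τ) = f τ)
    (hbdd : ∀ γ : SL(2, ℤ), IsBoundedAtImInfty (fun τ => f (γ • τ))) :
    ∃ c, ∀ τ, f τ = c := by
  have hslash : ∀ γ : SL(2, ℤ), SlashAction.map (0 : ℤ) γ f = fun τ => f (γ • τ) := by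
    intro γ
    ext τ
    rw [ModularForm.SL_slash_apply]
    simp
  let F : ModularForm ((CongruenceSubgroup.Gamma0 M).map
      (Matrix.SpecialLinearGroup.mapGL ℝ)) 0 :=
    { toFun := f
      slash_action_eq' := by
        rintro _ ⟨γ, hγ, rfl⟩
        refine (hslash γ).trans ?_
        ext τ
        exact hinv γ hγ τ
      holo' := hf
      bdd_at_cusps' := by
        intro c hc
        rw [Subgroup.IsArithmetic.isCusp_iff_isCusp_SL2Z] at hc
        rw [OnePoint.isBoundedAt_iff_forall_SL2Z hc]
        intro γ _
        exact (hslash γ) ▸ hbdd γ }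
  obtain ⟨c, hc⟩ := F.eq_const_of_weight_zero
  exact ⟨c, fun τ => congrFun hc τ⟩

/-- The algebra of holomorphic functions on the upper half plane which have at most a pole at `∞`
and are bounded at the cusps `γ ∞` with `γ ∉ Γ₀(M)`. -/
def poleAtInftySubalgebra (M : ℕ) : Subalgebra ℂ (ℍ → ℂ) where
  carrier := {f | MDiff f ∧ (∃ k : ℕ, IsBoundedAtImInfty (fun τ : ℍ => 𝕢 τ ^ k * f τ)) ∧
    ∀ γ ∉ CongruenceSubgroup.Gamma0 M, IsBoundedAtImInfty (fun τ : ℍ => f (γ • τ))}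
  mul_mem' := by
    rintro f g ⟨hf, ⟨k, hfk⟩, hfb⟩ ⟨hg, ⟨l, hgl⟩, hgb⟩
    refine ⟨hf.mul hg, ⟨k + l, ?_⟩, fun γ hγ =>
      Subalgebra.mul_mem (boundedAtImInftySubalgebra ℂ) (hfb γ hγ) (hgb γ hγ)⟩
    convert! Subalgebra.mul_mem (boundedAtImInftySubalgebra ℂ) hfk hgl using 1
    ext τ
    simp only [Pi.mul_apply]
    ring
  add_mem' := by
    rintro f g ⟨hf, ⟨k, hfk⟩, hfb⟩ ⟨hg, ⟨l, hgl⟩, hgb⟩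
    refine ⟨hf.add hg, ⟨k + l, ?_⟩, fun γ hγ =>
      Subalgebra.add_mem (boundedAtImInftySubalgebra ℂ) (hfb γ hγ) (hgb γ hγ)⟩
    convert! Subalgebra.add_mem (boundedAtImInftySubalgebra ℂ)
      (Subalgebra.mul_mem (boundedAtImInftySubalgebra ℂ) (isBoundedAtImInfty_qParam_pow l) hfk)
      (Subalgebra.mul_mem (boundedAtImInftySubalgebra ℂ) (isBoundedAtImInfty_qParam_pow k) hgl)
      using 1
    ext τ
    simp only [Pi.mul_apply, Pi.add_apply]
    ring
  algebraMap_mem' c := ⟨mdifferentiable_const, ⟨0, Subalgebra.mul_mem (boundedAtImInftySubalgebra ℂ)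
    (isBoundedAtImInfty_qParam_pow 0) (const_boundedAtFilter _ c)⟩,
    fun _ _ => const_boundedAtFilter _ c⟩

theorem mem_poleAtInftySubalgebra {M : ℕ} {f : ℍ → ℂ} : f ∈ poleAtInftySubalgebra M ↔
    MDiff f ∧ (∃ k : ℕ, IsBoundedAtImInfty (fun τ : ℍ => 𝕢 τ ^ k * f τ)) ∧
      ∀ γ ∉ CongruenceSubgroup.Gamma0 M, IsBoundedAtImInfty (fun τ : ℍ => f (γ • τ)) :=
  Iff.rfl

theorem IsHauptmodul.self_mem {M : ℕ} {t : ℍ → ℂ} (ht : IsHauptmodul M t) :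
    t ∈ poleAtInftySubalgebra M :=
  mem_poleAtInftySubalgebra.mpr ⟨ht.holo, ⟨1, by
    simp only [pow_one]; exact ht.simple_pole.isBigO_one ℝ⟩, ht.bounded⟩

/-- A function on `Y₀(M)` which is holomorphic outside `∞` and meromorphic at `∞` is a polynomial in
the Hauptmodul: subtracting a multiple of a power of `t` lowers the order of the pole. -/
theorem IsHauptmodul.exists_aeval_eq {M : ℕ} [NeZero M] {t : ℍ → ℂ} (ht : IsHauptmodul M t)
    {f : ℍ → ℂ} (hf : f ∈ poleAtInftySubalgebra M)
    (hinv : ∀ γ ∈ CongruenceSubgroup.Gamma0 M, ∀ τ : ℍ, f (γ • τ) = f τ) :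
    ∃ p : ℂ[X], Polynomial.aeval t p = f := by
  rw [mem_poleAtInftySubalgebra] at hf
  obtain ⟨k, hk⟩ := hf.2.1
  induction k generalizing f with
  | zero =>
    obtain ⟨c, hc⟩ := exists_eq_const hf.1 hinv fun γ => by
      by_cases hγ : γ ∈ CongruenceSubgroup.Gamma0 M
      · simpa only [hinv γ hγ, pow_zero, one_mul] using hk
      · exact hf.2.2 γ hγ
    exact ⟨Polynomial.C c, by ext τ; simp [hc]⟩
  | succ k ih =>
    set F : ℍ → ℂ := fun τ => 𝕢 τ ^ (k + 1) * f τ with hF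
    have hFd : MDiff F := (mdifferentiable_qParam_pow (k + 1)).mul hf.1
    have hFper : Function.Periodic (F ∘ ofComplex) ((1 : ℝ) : ℂ) :=
      periodic_comp_ofComplex_of_vadd fun τ => by
        simp only [hF, qParam_vadd_one, apply_vadd_of_invariant hinv]
    set c := valueAtInfty F
    have hFc : Tendsto F atImInfty (𝓝 c) := by
      have h1 := exp_decay_sub_atImInfty one_pos hFper hFd hk
      have h2 : Tendsto (fun τ : ℍ => Real.exp (-2 * Real.pi * τ.im / 1)) atImInfty (𝓝 0) := by
        have := (qParam_tendsto_atImInfty (one_pos)).norm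
        simpa [norm_qParam] using this
      have h3 : Tendsto (fun τ => F τ - c + c) atImInfty (𝓝 (0 + c)) :=
        (h1.trans_tendsto h2).add_const c
      simpa only [sub_add_cancel, zero_add] using h3
    set g : ℍ → ℂ := f - c • t ^ (k + 1) with hg
    have hgmem : g ∈ poleAtInftySubalgebra M :=
      Subalgebra.sub_mem _ (mem_poleAtInftySubalgebra.mpr hf) (Subalgebra.smul_mem _
        (Subalgebra.pow_mem _ ht.self_mem _) c)
    have hginv : ∀ γ ∈ CongruenceSubgroup.Gamma0 M, ∀ τ : ℍ, g (γ • τ) = g τ := by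
      intro γ hγ τ
      simp only [hg, Pi.sub_apply, Pi.smul_apply, Pi.pow_apply, hinv γ hγ, ht.invariant γ hγ]
    set G : ℍ → ℂ := fun τ => 𝕢 τ ^ (k + 1) * g τ with hG
    have hGd : MDiff G :=
      (mdifferentiable_qParam_pow (k + 1)).mul (mem_poleAtInftySubalgebra.mp hgmem).1
    have hGper : Function.Periodic (G ∘ ofComplex) ((1 : ℝ) : ℂ) :=
      periodic_comp_ofComplex_of_vadd fun τ => by
        simp only [hG, qParam_vadd_one, apply_vadd_of_invariant hginv]
    have hG0 : IsZeroAtImInfty G := by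
      have h := hFc.sub ((ht.simple_pole.pow (k + 1)).const_mul c)
      rw [one_pow, mul_one, sub_self] at h
      refine h.congr fun τ => ?_
      simp only [hF, hG, hg, Pi.sub_apply, Pi.smul_apply, Pi.pow_apply, smul_eq_mul]
      ring
    have hdecay := hG0.exp_decay_atImInfty one_pos hGper hGd hG0.isBoundedAtImInfty
    have hgk : IsBoundedAtImInfty (fun τ : ℍ => 𝕢 τ ^ k * g τ) := by
      obtain ⟨C, hC⟩ := hdecay.bound
      refine Asymptotics.IsBigO.of_bound C ?_
      filter_upwards [hC] with τ hτ
      have hq : Real.exp (-2 * Real.pi * τ.im / 1) = ‖𝕢 (τ : ℂ)‖ := by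
        rw [norm_qParam, coe_im]
      rw [hq, norm_norm] at hτ
      have hpos : 0 < ‖𝕢 (τ : ℂ)‖ := norm_pos_iff.mpr (qParam_ne_zero _)
      have e : ‖G τ‖ = ‖𝕢 (τ : ℂ) ^ k * g τ‖ * ‖𝕢 (τ : ℂ)‖ := by
        rw [← norm_mul, hG]
        congr 1
        ring
      rw [e] at hτ
      simpa using le_of_mul_le_mul_right hτ hpos
    obtain ⟨p, hp⟩ := ih (mem_poleAtInftySubalgebra.mp hgmem) hginv hgk
    refine ⟨p + Polynomial.C c * Polynomial.X ^ (k + 1), ?_⟩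
    rw [map_add, hp, map_mul, map_pow, Polynomial.aeval_X, Polynomial.aeval_C, hg,
      ← Algebra.smul_def, sub_add_cancel]

/-! ### The conjugates `t((a τ + b) / d)` of the Hauptmodul -/

section Conjugates

variable {M N : ℕ} {t : ℍ → ℂ}

/-- The conjugates of the Hauptmodul have at most a pole at `∞`, and they are bounded at the cusps
`γ ∞` with `γ ∉ Γ₀(M)`, since Hermite forms preserve this set of cusps. -/
theorem IsHauptmodul.comp_pt_mem (ht : IsHauptmodul M t) (hN : 0 < N) (hMN : Nat.Coprime M N)
    (s : HermiteForm N) : (fun τ => t (s.pt τ)) ∈ poleAtInftySubalgebra M := by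
  refine mem_poleAtInftySubalgebra.mpr ⟨s.mdifferentiable_comp_pt ht.holo, ⟨N, ?_⟩, fun γ hγ => ?_⟩
  · -- `|q(τ)| ^ N ≤ |q((a τ + b) / d)|`, since `a / d ≤ N`.
    have h1 : IsBoundedAtImInfty (fun τ : ℍ => 𝕢 (s.pt τ) * t (s.pt τ)) :=
      (ht.simple_pole.comp s.tendsto_pt).isBigO_one ℝ
    refine Asymptotics.IsBigO.trans (Asymptotics.isBigO_of_le _ fun τ => ?_) h1
    rw [norm_mul, norm_mul]
    refine mul_le_mul_of_nonneg_right ?_ (norm_nonneg _)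
    rw [norm_pow, norm_qParam, norm_qParam, ← Real.exp_nat_mul, Real.exp_le_exp, coe_im, coe_im,
      s.im_pt]
    have h2 : (s.a / s.d : ℝ) ≤ N := by
      rw [div_le_iff₀ (by exact_mod_cast s.d_pos)]
      have := s.a_le
      have := s.d_pos
      have : s.a ≤ N * s.d := by nlinarith
      exact_mod_cast this
    have h3 : (s.a / s.d : ℝ) * τ.im ≤ N * τ.im := mul_le_mul_of_nonneg_right h2 τ.im_pos.le
    nlinarith [Real.pi_pos]
  · obtain ⟨γ', s', h⟩ := s.exists_mat_mul hN γ
    have hγ' := (HermiteForm.mem_Gamma0_iff hMN h).not.mp hγ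
    simp only [HermiteForm.pt_smul h]
    exact (ht.bounded γ' hγ').comp_tendsto s'.tendsto_pt

/-- The conjugates of the Hauptmodul are distinguished by the leading terms of their expansions
at `∞`. -/
theorem IsHauptmodul.eq_of_comp_pt_eq (ht : IsHauptmodul M t) {s s' : HermiteForm N}
    (h : (fun τ => t (s.pt τ)) = fun τ => t (s'.pt τ)) : s = s' := by
  have hlim : Tendsto (fun τ : ℍ => 𝕢 (s.pt τ) / 𝕢 (s'.pt τ)) atImInfty (𝓝 1) := by
    have h1 := ht.simple_pole.comp s.tendsto_pt
    have h2 := ht.simple_pole.comp s'.tendsto_pt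
    have h3 := h1.div h2 one_ne_zero
    rw [div_one] at h3
    refine h3.congr' ?_
    filter_upwards [h2.eventually_ne one_ne_zero] with τ hτ
    have e := congrFun h τ
    simp only [Function.comp_apply, Pi.div_apply] at hτ e ⊢
    rw [e, mul_div_mul_right _ _ (right_ne_zero_of_mul hτ)]
  have ha : (0 : ℝ) < s.a := by exact_mod_cast s.a_pos
  have hd : (0 : ℝ) < s.d := by exact_mod_cast s.d_pos
  have ha' : (0 : ℝ) < s'.a := by exact_mod_cast s'.a_pos
  have hd' : (0 : ℝ) < s'.d := by exact_mod_cast s'.d_pos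
  have hN : (s.a * s.d : ℝ) = s'.a * s'.d := by exact_mod_cast s.mul_eq.trans s'.mul_eq.symm
  -- The absolute value of the quotient shows that `a / d = a' / d'`.
  have hκ : (s.a / s.d : ℝ) = s'.a / s'.d := by
    by_contra hne
    have h1 := (hlim.norm.log (by simp)).const_mul (-(2 * Real.pi * (s.a / s.d - s'.a / s'.d))⁻¹)
    have h2 : Tendsto (fun τ : ℍ => τ.im) atImInfty (𝓝 0) := by
      rw [norm_one, Real.log_one, mul_zero] at h1
      refine h1.congr fun τ => ?_
      rw [norm_div, norm_qParam, norm_qParam, ← Real.exp_sub, Real.log_exp, coe_im, coe_im,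
        s.im_pt, s'.im_pt]
      have := sub_ne_zero.mpr hne
      rw [neg_mul, inv_mul_eq_div, neg_eq_iff_eq_neg, div_eq_iff (by positivity)]
      ring
    have h3 : Tendsto (fun τ : ℍ => τ.im) atImInfty atTop := tendsto_comap
    exact not_tendsto_nhds_of_tendsto_atTop h3 _ h2
  have haa : s.a = s'.a := by
    rw [div_eq_div_iff hd.ne' hd'.ne'] at hκ
    have : (s.a : ℝ) ^ 2 = (s'.a : ℝ) ^ 2 := by
      apply mul_right_cancel₀ hd'.ne'
      linear_combination s.a * hκ + s'.a * hN
    exact_mod_cast (sq_eq_sq₀ ha.le ha'.le).mp this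
  have hdd : s.d = s'.d := by
    have := s.mul_eq.trans s'.mul_eq.symm
    rw [haa] at this
    exact mul_left_cancel₀ s'.a_pos.ne' this
  have hconst : ∀ τ : ℍ, 𝕢 (s.pt τ) / 𝕢 (s'.pt τ) =
      Complex.exp (2 * Real.pi * Complex.I * ((s.b - s'.b) / s.d)) := by
    intro τ
    rw [qParam, qParam, ← Complex.exp_sub, s.coe_pt, s'.coe_pt, haa, hdd]
    congr 1
    push_cast
    ring
  simp only [hconst] at hlim
  obtain ⟨n, hn⟩ := Complex.exp_eq_one_iff.mp (tendsto_const_nhds_iff.mp hlim)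
  have hbb : s.b - s'.b = n * s.d := by
    have h1 : ((s.b : ℂ) - s'.b) / s.d = n := by
      apply mul_left_cancel₀ Complex.two_pi_I_ne_zero
      rw [hn, mul_comm]
    rw [div_eq_iff (by exact_mod_cast s.d_pos.ne')] at h1
    exact_mod_cast h1
  have hb : s.b = s'.b := by
    rw [← Int.emod_eq_of_lt s.b_nonneg s.b_lt, ← Int.emod_eq_of_lt s'.b_nonneg s'.b_lt, ← hdd,
      show s.b = s'.b + n * s.d by linarith]
    simp
  exact HermiteForm.ext haa hb hdd

/-- Right multiplication by an element of `Γ₀(M)` on the classes of matrices is injective, so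
`Γ₀(M)` permutes the conjugates of the Hauptmodul. -/
theorem IsHauptmodul.exists_perm (ht : IsHauptmodul M t) (hN : 0 < N) (hMN : Nat.Coprime M N)
    {γ : SL(2, ℤ)} (hγ : γ ∈ CongruenceSubgroup.Gamma0 M) :
    ∃ σ : Equiv.Perm (HermiteForm N), ∀ s τ, t (s.pt (γ • τ)) = t ((σ s).pt τ) := by
  choose γ' σ h using fun s : HermiteForm N => s.exists_mat_mul hN γ
  have hσ : Function.Injective σ := by
    intro s₁ s₂ h12
    refine s₁.eq_of_mat_eq_mul s₂ (γ' s₁ * (γ' s₂)⁻¹) ?_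
    have h1 := h s₁
    have h2 := h s₂
    have e1 : s₁.mat = ((γ' s₁ : SL(2, ℤ)) : Matrix (Fin 2) (Fin 2) ℤ) * (σ s₁).mat *
        ((γ⁻¹ : SL(2, ℤ)) : Matrix (Fin 2) (Fin 2) ℤ) := by
      rw [← h1, Matrix.mul_assoc, ← Matrix.SpecialLinearGroup.coe_mul, mul_inv_cancel,
        Matrix.SpecialLinearGroup.coe_one, Matrix.mul_one]
    have e2 : (σ s₂).mat = (((γ' s₂)⁻¹ : SL(2, ℤ)) : Matrix (Fin 2) (Fin 2) ℤ) * s₂.mat *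
        (γ : Matrix (Fin 2) (Fin 2) ℤ) := by
      rw [Matrix.mul_assoc, h2, ← Matrix.mul_assoc, ← Matrix.SpecialLinearGroup.coe_mul,
        inv_mul_cancel, Matrix.SpecialLinearGroup.coe_one, Matrix.one_mul]
    rw [e1, h12, e2, Matrix.SpecialLinearGroup.coe_mul]
    simp only [Matrix.mul_assoc]
    rw [← Matrix.SpecialLinearGroup.coe_mul γ, mul_inv_cancel,
      Matrix.SpecialLinearGroup.coe_one, Matrix.mul_one]
  refine ⟨Equiv.ofBijective σ (Finite.injective_iff_bijective.mp hσ), fun s τ => ?_⟩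
  rw [HermiteForm.pt_smul (h s),
    ht.invariant _ ((HermiteForm.mem_Gamma0_iff hMN (h s)).mp hγ)]
  rfl

/-- The group `Γ₀(M)` acts transitively on the conjugates of the Hauptmodul. -/
theorem IsHauptmodul.exists_comp_pt_diag (ht : IsHauptmodul M t) (hN : 0 < N)
    (hMN : Nat.Coprime M N) (s : HermiteForm N) :
    ∃ γ ∈ CongruenceSubgroup.Gamma0 M, ∀ τ,
      t ((HermiteForm.diag N hN).pt (γ • τ)) = t (s.pt τ) := by
  obtain ⟨γ, hγ, γ', hγ', h⟩ := s.exists_diag_mul hN hMN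
  exact ⟨γ, hγ, fun τ => by rw [HermiteForm.pt_smul h, ht.invariant _ hγ']⟩

end Conjugates

end Analysis

/-! ### Isogenies as multiplications by complex numbers -/

namespace EllCurve

variable (E : EllCurve)

theorem proj_eq_zero {z : ℂ} : E.proj z = 0 ↔ z ∈ E.lattice :=
  Submodule.Quotient.mk_eq_zero _

theorem proj_eq_proj {z w : ℂ} : E.proj z = E.proj w ↔ z - w ∈ E.lattice :=
  Submodule.Quotient.eq _

theorem proj_surjective : Function.Surjective E.proj :=
  Submodule.Quotient.mk_surjective _

theorem proj_add (z w : ℂ) : E.proj (z + w) = E.proj z + E.proj w := rfl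

theorem zsmul_proj (k : ℤ) (z : ℂ) : k • E.proj z = E.proj (k * z) := by
  rw [← zsmul_eq_mul]; rfl

/-- An isogeny determines its multiplier: the difference of two multipliers maps `ℂ` into the
lattice, which does not contain half of a basis vector. -/
theorem eq_of_forall_proj_eq {α β : ℂ} (h : ∀ z, E.proj (α * z) = E.proj (β * z)) : α = β := by
  by_contra hne
  obtain ⟨L, hL⟩ := E.isLattice
  apply L.ω₁_div_two_notMem_lattice
  rw [hL]
  have h1 := E.proj_eq_proj.mp (h ((L.ω₁ / 2) / (α - β)))
  rwa [← sub_mul, mul_div_cancel₀ _ (sub_ne_zero.mpr hne)] at h1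

end EllCurve

namespace Isogeny

variable {E₁ E₂ E₃ : EllCurve}

/-- The isogeny induced by multiplication by `α`. -/
def ofMul (α : ℂ) (hα : α ≠ 0) (h : ∀ z ∈ E₁.lattice, α * z ∈ E₂.lattice) : Isogeny E₁ E₂ where
  hom := (Submodule.mapQ E₁.lattice E₂.lattice (LinearMap.mulLeft ℤ α) h).toAddMonoidHom
  exists_mul := ⟨α, hα, fun _ => rfl⟩

theorem mul_mem_lattice {f : Isogeny E₁ E₂} {α : ℂ} (hf : ∀ z, f.hom (E₁.proj z) = E₂.proj (α * z))
    {z : ℂ} (hz : z ∈ E₁.lattice) : α * z ∈ E₂.lattice := by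
  rw [← E₂.proj_eq_zero, ← hf, E₁.proj_eq_zero.mpr hz, map_zero]

theorem isIso_iff {f : Isogeny E₁ E₂} {α : ℂ} (hα : α ≠ 0)
    (hf : ∀ z, f.hom (E₁.proj z) = E₂.proj (α * z)) :
    f.IsIso ↔ ∀ z, α * z ∈ E₂.lattice → z ∈ E₁.lattice := by
  constructor
  · intro h z hz
    rw [← E₁.proj_eq_zero]
    apply h.1
    rw [hf, map_zero, E₂.proj_eq_zero]
    exact hz
  · intro h
    refine ⟨(injective_iff_map_eq_zero _).mpr fun x hx => ?_, fun y => ?_⟩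
    · obtain ⟨z, rfl⟩ := E₁.proj_surjective x
      rw [hf, E₂.proj_eq_zero] at hx
      exact E₁.proj_eq_zero.mpr (h z hx)
    · obtain ⟨w, rfl⟩ := E₂.proj_surjective y
      exact ⟨E₁.proj (α⁻¹ * w), by rw [hf, mul_inv_cancel_left₀ hα]⟩

theorem ker_comp (g : Isogeny E₂ E₃) (hg : g.IsIso) (f : Isogeny E₁ E₂) :
    (g.comp f).hom.ker = f.hom.ker := by
  ext x
  change g.hom (f.hom x) = 0 ↔ f.hom x = 0
  exact map_eq_zero_iff g.hom hg.1

end Isogeny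

/-! ### The points of `Y₀(M)` -/

theorem mem_tauCurve {τ : ℍ} {z : ℂ} :
    z ∈ (tauCurve τ).lattice ↔ ∃ m n : ℤ, (m : ℂ) * τ + n = z := by
  change z ∈ (tauPair τ).lattice ↔ _
  rw [PeriodPair.mem_lattice]
  simp [tauPair]

theorem int_mul_add_inj {τ : ℍ} {m n m' n' : ℤ} (h : (m : ℂ) * τ + n = m' * τ + n') :
    m = m' ∧ n = n' := by
  have him := congrArg Complex.im h
  simp at him
  have hm : m = m' := him.resolve_right τ.im_ne_zero
  subst hm
  exact ⟨rfl, by exact_mod_cast add_left_cancel h⟩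

/-- If the pairs attached to `τ` and `τ'` are isomorphic, then `τ` and `τ'` are equivalent under
`Γ₀(M)`. -/
theorem exists_smul_eq_of_iso {M : ℕ} [NeZero M] {τ τ' : ℍ}
    (h : (tauLevel M τ).Iso (tauLevel M τ')) :
    ∃ γ ∈ CongruenceSubgroup.Gamma0 M, γ • τ' = τ := by
  obtain ⟨g, hg, hC⟩ := h
  obtain ⟨α, hα, hmul⟩ := g.exists_mul
  have hinv := (Isogeny.isIso_iff hα hmul).mp hg
  obtain ⟨p, q, hpq⟩ := mem_tauCurve.mp
    (Isogeny.mul_mem_lattice hmul (mem_tauCurve.mpr ⟨1, 0, rfl⟩))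
  obtain ⟨r, u, hru⟩ := mem_tauCurve.mp
    (Isogeny.mul_mem_lattice hmul (mem_tauCurve.mpr ⟨0, 1, rfl⟩))
  obtain ⟨p₂, q₂, hpq₂⟩ := mem_tauCurve.mp (hinv (α⁻¹ * τ') (by
    rw [mul_inv_cancel_left₀ hα]; exact mem_tauCurve.mpr ⟨1, 0, by simp⟩))
  obtain ⟨r₂, u₂, hru₂⟩ := mem_tauCurve.mp (hinv α⁻¹ (by
    rw [mul_inv_cancel₀ hα]; exact mem_tauCurve.mpr ⟨0, 1, by simp⟩))
  push_cast at hpq hru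
  -- The matrix of `α` in the bases `(τ, 1)` and `(τ', 1)` is invertible over `ℤ`.
  have e1 : ((p₂ * p + q₂ * r : ℤ) : ℂ) * τ' + (p₂ * q + q₂ * u : ℤ)
      = (1 : ℤ) * τ' + (0 : ℤ) := by
    push_cast
    have : α * (p₂ * τ + q₂) = τ' := by rw [hpq₂, mul_inv_cancel_left₀ hα]
    linear_combination this + p₂ * hpq + q₂ * hru
  have e2 : ((r₂ * p + u₂ * r : ℤ) : ℂ) * τ' + (r₂ * q + u₂ * u : ℤ)
      = (0 : ℤ) * τ' + (1 : ℤ) := by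
    push_cast
    have : α * (r₂ * τ + u₂) = 1 := by rw [hru₂, mul_inv_cancel₀ hα]
    linear_combination this + r₂ * hpq + u₂ * hru
  obtain ⟨e11, e12⟩ := int_mul_add_inj e1
  obtain ⟨e21, e22⟩ := int_mul_add_inj e2
  have hdet : (p * u - q * r) * (p₂ * u₂ - q₂ * r₂) = 1 := by
    linear_combination e11 * (r₂ * q + u₂ * u) + e22 - e12 * (r₂ * p + u₂ * r)
  have hαr : α = r * τ' + u := by linear_combination -hru
  have hατ : α * τ = p * τ' + q := by linear_combination -hpq
  have hpos : 0 < p * u - q * r := by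
    have h1 : (α * τ * (starRingEnd ℂ) α).im = Complex.normSq α * τ.im := by
      rw [mul_right_comm, Complex.mul_conj, Complex.im_ofReal_mul, UpperHalfPlane.coe_im]
    have h2 : (α * τ * (starRingEnd ℂ) α).im = (p * u - q * r : ℤ) * τ'.im := by
      rw [hατ, hαr]
      simp
      ring
    have h3 : 0 < ((p * u - q * r : ℤ) : ℝ) * τ'.im := by
      rw [← h2, h1]
      exact mul_pos (Complex.normSq_pos.mpr hα) τ.im_pos
    exact_mod_cast pos_of_mul_pos_left h3 τ'.im_pos.le
  have hdet1 : p * u - q * r = 1 := Int.eq_one_of_mul_eq_one_right hpos.le hdet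
  let γ : SL(2, ℤ) := ⟨!![p, q; r, u], by rw [Matrix.det_fin_two_of, hdet1]⟩
  refine ⟨γ, ?_, ?_⟩
  · rw [CongruenceSubgroup.Gamma0_mem, ZMod.intCast_zmod_eq_zero_iff_dvd]
    have hM : (M : ℂ) ≠ 0 := Nat.cast_ne_zero.mpr (NeZero.ne M)
    have h1 : g.hom ((tauCurve τ).proj (1 / M : ℂ)) ∈ (tauLevel M τ').C := by
      rw [← hC]
      exact AddSubgroup.mem_map_of_mem _ (AddSubgroup.mem_zmultiples _)
    obtain ⟨k, hk⟩ := AddSubgroup.mem_zmultiples_iff.mp h1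
    have hk' : (tauCurve τ').proj (k * (1 / M : ℂ)) = (tauCurve τ').proj (α * (1 / M : ℂ)) := by
      rw [← EllCurve.zsmul_proj]
      exact hk.trans (hmul _)
    obtain ⟨m, n, hmn⟩ := mem_tauCurve.mp ((tauCurve τ').proj_eq_proj.mp hk')
    have e : ((M * m : ℤ) : ℂ) * τ' + (M * n : ℤ) = (-r : ℤ) * τ' + (k - u : ℤ) := by
      push_cast
      field_simp at hmn
      linear_combination hmn - hαr
    have := (int_mul_add_inj e).1
    exact ⟨-m, by simp [γ]; linarith⟩
  · ext
    rw [UpperHalfPlane.coe_specialLinearGroup_apply]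
    simp [γ]
    rw [← hαr, ← hατ, mul_div_cancel_left₀ _ hα]

theorem value_tauLevel {M : ℕ} [NeZero M] {t : ℍ → ℂ}
    (ht : ∀ γ ∈ CongruenceSubgroup.Gamma0 M, ∀ τ : ℍ, t (γ • τ) = t τ) (τ : ℍ) :
    value M t (tauLevel M τ) = t τ := by
  have hne : {τ' : ℍ | (tauLevel M τ).Iso (tauLevel M τ')}.Nonempty :=
    ⟨τ, Isogeny.id _, Function.bijective_id, AddSubgroup.map_id _⟩
  rw [value, dif_pos hne]
  obtain ⟨γ, hγ, h⟩ := exists_smul_eq_of_iso hne.some_mem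
  rw [← ht γ hγ, h]

/-- Every elliptic curve with a cyclic subgroup of order `M` is isomorphic to a pair
`(E_τ, ⟨1/M⟩)`. -/
theorem LevelCurve.exists_iso_tauLevel {M : ℕ} [NeZero M] (X : LevelCurve M) :
    ∃ τ : ℍ, X.Iso (tauLevel M τ) := by
  obtain ⟨L, hL⟩ := X.E.isLattice
  have hM : (M : ℂ) ≠ 0 := Nat.cast_ne_zero.mpr (NeZero.ne M)
  have hM' : (M : ℤ) ≠ 0 := Nat.cast_ne_zero.mpr (NeZero.ne M)
  obtain ⟨⟨c, hcC⟩, hc⟩ := X.cyclic.exists_generator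
  have hCc : X.C = AddSubgroup.zmultiples c := by
    refine le_antisymm (fun x hx => ?_) ((AddSubgroup.zmultiples_le_of_mem hcC))
    obtain ⟨k, hk⟩ := hc ⟨x, hx⟩
    exact ⟨k, congrArg Subtype.val hk⟩
  have hord : addOrderOf c = M := by rw [← Nat.card_zmultiples, ← hCc, X.card]
  obtain ⟨w, rfl⟩ := X.E.proj_surjective c
  have hk : ∀ k : ℤ, k * w ∈ X.E.lattice ↔ (M : ℤ) ∣ k := fun k => by
    rw [← X.E.proj_eq_zero, ← EllCurve.zsmul_proj, ← addOrderOf_dvd_iff_zsmul_eq_zero, hord]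
  have hmem : ∀ z, z ∈ X.E.lattice ↔ ∃ m n : ℤ, m * L.ω₁ + n * L.ω₂ = z := fun z => by
    rw [← hL, PeriodPair.mem_lattice]
  obtain ⟨x, y, hxy⟩ := (hmem _).mp ((hk M).mpr dvd_rfl)
  -- The coordinates of `M w` are coprime together with `M`, as `w` has order exactly `M`.
  have hprim : ∃ i j l : ℤ, x * i + y * j + M * l = 1 := by
    have hg := Int.gcd_eq_gcd_ab (Int.gcd x y) M
    have hg' := Int.gcd_eq_gcd_ab x y
    obtain ⟨M', hM1⟩ := Int.gcd_dvd_right (Int.gcd x y) M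
    obtain ⟨e, he⟩ := Int.gcd_dvd_left (Int.gcd x y) M
    obtain ⟨x', hx'⟩ := Int.gcd_dvd_left x y
    obtain ⟨y', hy'⟩ := Int.gcd_dvd_right x y
    have hnn : (0 : ℤ) ≤ Int.gcd (Int.gcd x y) M := Int.natCast_nonneg _
    generalize (Int.gcd (Int.gcd x y) M : ℤ) = g at *
    generalize (Int.gcd x y : ℤ) = g' at *
    have hg0 : g ≠ 0 := by rintro rfl; exact hM' (by rw [hM1, zero_mul])
    have hM'0 : M' ≠ 0 := by rintro rfl; exact hM' (by rw [hM1, mul_zero])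
    have h1 : (M' : ℂ) * w ∈ X.E.lattice := by
      refine (hmem _).mpr ⟨e * x', e * y', ?_⟩
      have hgC : (g : ℂ) ≠ 0 := Int.cast_ne_zero.mpr hg0
      apply mul_left_cancel₀ hgC
      have a1 : (x : ℂ) = g * e * x' := by rw [hx', he]; push_cast; ring
      have a2 : (y : ℂ) = g * e * y' := by rw [hy', he]; push_cast; ring
      have a3 : (M : ℂ) = g * M' := by exact_mod_cast hM1
      push_cast at hxy ⊢
      linear_combination hxy - L.ω₁ * a1 - L.ω₂ * a2 + w * a3
    obtain ⟨f, hf⟩ := (hk M').mp h1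
    have hg1 : g = 1 := by
      have : g * f = 1 := by
        apply mul_left_cancel₀ hM'0
        linear_combination -hf - f * hM1
      exact Int.eq_one_of_mul_eq_one_right hnn this
    rw [hg1] at hg
    exact ⟨Int.gcdA x y * Int.gcdA g' M, Int.gcdB x y * Int.gcdA g' M, Int.gcdB g' M, by
      linear_combination -hg - Int.gcdA g' M * hg'⟩
  -- Hence `w` can be changed by a lattice vector so that the coordinates of `M w` become coprime.
  obtain ⟨x, y, w', hw', hxy', i, j, hij⟩ : ∃ (x' y' : ℤ) (w' : ℂ), X.E.proj w' = X.E.proj w ∧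
      x' * L.ω₁ + y' * L.ω₂ = M * w' ∧ ∃ i j : ℤ, x' * i + y' * j = 1 := by
    obtain ⟨y', l₀, hy', hl₀⟩ : ∃ y' l₀ : ℤ, y' ≠ 0 ∧ y' = y + l₀ * M := by
      by_cases hy : y = 0
      · exact ⟨M, 1, hM', by rw [hy]; ring⟩
      · exact ⟨y, 0, hy, by ring⟩
    obtain ⟨i, j, l, h⟩ := hprim
    obtain ⟨k, e, f, hef⟩ := exists_isCoprime_add_mul (a := y') (b := x) (d := M) hy'
      ⟨j, i, l - l₀ * j, by rw [hl₀]; linear_combination h⟩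
    refine ⟨x + k * M, y', w + (k * L.ω₁ + l₀ * L.ω₂), ?_, ?_, e, f, by linear_combination hef⟩
    · rw [X.E.proj_eq_proj, add_sub_cancel_left]
      exact (hmem _).mpr ⟨k, l₀, rfl⟩
    · rw [hl₀]
      push_cast at hxy ⊢
      linear_combination hxy
  rw [← hw'] at hCc
  clear hxy hprim
  set ω₂' : ℂ := x * L.ω₁ + y * L.ω₂ with hω₂'
  have hlin : ∀ a b : ℝ, (a : ℂ) * L.ω₁ + b * L.ω₂ = 0 → a = 0 ∧ b = 0 := fun a b h =>
    LinearIndependent.pair_iff.mp L.indep a b (by simpa using h)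
  have hω₂0 : ω₂' ≠ 0 := by
    intro h0
    obtain ⟨h1, h2⟩ := hlin x y (by push_cast; exact h0)
    rw [Int.cast_eq_zero] at h1 h2
    simp [h1, h2] at hij
  -- Complete `M w` to an oriented basis of the lattice.
  obtain ⟨ε, hε, him⟩ : ∃ ε : ℤ, ε * ε = 1 ∧
      0 < ((ε : ℂ) * (j * L.ω₁ - i * L.ω₂) / ω₂').im := by
    have hne : ((j * L.ω₁ - i * L.ω₂) / ω₂').im ≠ 0 := by
      intro h0
      set r := ((j * L.ω₁ - i * L.ω₂) / ω₂').re with hr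
      have h1 : (j * L.ω₁ - i * L.ω₂) / ω₂' = (r : ℂ) := Complex.ext (by simp [hr]) (by simp [h0])
      rw [div_eq_iff hω₂0] at h1
      obtain ⟨h2, h3⟩ := hlin (j - r * x) (-i - r * y) (by
        push_cast
        linear_combination h1 + r * hω₂')
      have h4 : (x : ℝ) * i + y * j = 1 := by exact_mod_cast hij
      have : (1 : ℝ) = 0 := by linear_combination -h4 + y * h2 - x * h3
      exact one_ne_zero this
    rcases hne.lt_or_gt with h | h
    · refine ⟨-1, by ring, ?_⟩
      have e : (((-1 : ℤ) : ℂ) * (j * L.ω₁ - i * L.ω₂) / ω₂')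
          = -((j * L.ω₁ - i * L.ω₂) / ω₂') := by push_cast; ring
      rw [e, Complex.neg_im]
      linarith
    · exact ⟨1, by ring, by simpa using h⟩
  let τ : ℍ := ⟨(ε : ℂ) * (j * L.ω₁ - i * L.ω₂) / ω₂', him⟩
  have hτ : (τ : ℂ) * ω₂' = ε * (j * L.ω₁ - i * L.ω₂) := div_mul_cancel₀ _ hω₂0
  have hεC : (ε : ℂ) * ε = 1 := by exact_mod_cast hε
  have hijC : (x : ℂ) * i + y * j = 1 := by exact_mod_cast hij
  have hto : ∀ z ∈ X.E.lattice, ω₂'⁻¹ * z ∈ (tauCurve τ).lattice := by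
    intro z hz
    obtain ⟨m, n, rfl⟩ := (hmem z).mp hz
    refine mem_tauCurve.mpr ⟨ε * (y * m - x * n), i * m + j * n, ?_⟩
    rw [eq_inv_mul_iff_mul_eq₀ hω₂0]
    push_cast
    linear_combination (ε * (y * m - x * n)) * hτ
      + ((y * m - x * n) * (j * L.ω₁ - i * L.ω₂)) * hεC + (i * m + j * n) * hω₂'
      + (m * L.ω₁ + n * L.ω₂) * hijC
  have hfrom : ∀ z, ω₂'⁻¹ * z ∈ (tauCurve τ).lattice → z ∈ X.E.lattice := by
    intro z hz
    obtain ⟨m, n, h⟩ := mem_tauCurve.mp hz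
    rw [eq_inv_mul_iff_mul_eq₀ hω₂0] at h
    refine (hmem z).mpr ⟨m * ε * j + n * x, -(m * ε * i) + n * y, ?_⟩
    rw [← h]
    push_cast
    linear_combination -m * hτ - n * hω₂'
  refine ⟨τ, Isogeny.ofMul ω₂'⁻¹ (inv_ne_zero hω₂0) hto,
    (Isogeny.isIso_iff (inv_ne_zero hω₂0) fun _ => rfl).mpr hfrom, ?_⟩
  rw [hCc, AddMonoidHom.map_zmultiples]
  change AddSubgroup.zmultiples ((tauCurve τ).proj (ω₂'⁻¹ * w')) = _
  have e : ω₂'⁻¹ * w' = 1 / M := by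
    rw [inv_mul_eq_div, div_eq_div_iff hω₂0 hM, one_mul, hxy', mul_comm]
  rw [e]
  rfl

/-! ### Classification of cyclic isogenies -/

section Classification

variable {M N : ℕ}

theorem zmultiples_zsmul_eq {A : Type*} [AddCommGroup A] {x : A} {d : ℤ}
    (h : IsCoprime d (addOrderOf x : ℤ)) :
    AddSubgroup.zmultiples (d • x) = AddSubgroup.zmultiples x := by
  obtain ⟨e, f, hef⟩ := h
  refine le_antisymm (AddSubgroup.zmultiples_le_of_mem ⟨d, rfl⟩)
    (AddSubgroup.zmultiples_le_of_mem ⟨e, ?_⟩)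
  have h0 : (f * (addOrderOf x : ℤ)) • x = 0 := by
    rw [mul_smul, natCast_zsmul, addOrderOf_nsmul_eq_zero, smul_zero]
  calc e • (d • x) = (e * d + f * (addOrderOf x : ℤ)) • x := by
        rw [add_smul, h0, add_zero, mul_smul]
    _ = x := by rw [hef, one_smul]

/-- A subgroup of order prime to the order of the kernel is determined by its image. -/
theorem le_of_map_le_map {A B : Type*} [AddCommGroup A] [AddCommGroup B] (f : A →+ B)
    (hMN : Nat.Coprime M N) (hker : Nat.card f.ker = N) {C D : AddSubgroup A}
    (hC : Nat.card C = M) (hD : Nat.card D = M) (h : C.map f ≤ D.map f) : C ≤ D := by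
  intro x hx
  obtain ⟨y, hy, hxy⟩ := h (AddSubgroup.mem_map_of_mem f hx)
  have hMx : M • x = 0 := by
    have := card_nsmul_eq_zero' (x := (⟨x, hx⟩ : C))
    rw [hC] at this
    exact congrArg Subtype.val this
  have hMy : M • y = 0 := by
    have := card_nsmul_eq_zero' (x := (⟨y, hy⟩ : D))
    rw [hD] at this
    exact congrArg Subtype.val this
  have hxyk : x - y ∈ f.ker := by rw [AddMonoidHom.mem_ker, map_sub, hxy, sub_self]
  have hN : N • (x - y) = 0 := by
    have := card_nsmul_eq_zero' (x := (⟨x - y, hxyk⟩ : f.ker))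
    rw [hker] at this
    exact congrArg Subtype.val this
  have hM : M • (x - y) = 0 := by rw [nsmul_sub, hMx, hMy, sub_self]
  have h0 : x - y = 0 := by
    rw [← AddMonoid.addOrderOf_eq_one_iff, ← Nat.dvd_one, ← hMN.gcd_eq_one]
    exact Nat.dvd_gcd (addOrderOf_dvd_of_nsmul_eq_zero hM) (addOrderOf_dvd_of_nsmul_eq_zero hN)
  rw [sub_eq_zero.mp h0]
  exact hy

namespace HermiteForm

variable (s : HermiteForm N) (τ : ℍ)

theorem d_ne_zero : (s.d : ℂ) ≠ 0 := Int.cast_ne_zero.mpr s.d_pos.ne'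

theorem mem_tauCurve_pt {u v : ℤ} :
    ((u : ℂ) * τ + v) / s.d ∈ (tauCurve (s.pt τ)).lattice ↔
      ∃ m n : ℤ, u = m * s.a ∧ v = m * s.b + n * s.d := by
  rw [mem_tauCurve]
  refine exists_congr fun m => exists_congr fun n => ?_
  rw [eq_div_iff s.d_ne_zero, s.coe_pt]
  have e : ((m : ℂ) * ((s.a * τ + s.b) / s.d) + n) * s.d
      = (m * s.a : ℤ) * τ + (m * s.b + n * s.d : ℤ) := by
    have := s.d_ne_zero
    push_cast
    field_simp
    ring
  rw [e]
  constructor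
  · intro h
    obtain ⟨h1, h2⟩ := int_mul_add_inj h
    exact ⟨h1.symm, h2.symm⟩
  · rintro ⟨rfl, rfl⟩
    rfl

theorem mul_mem_tauCurve {z : ℂ} (hz : z ∈ (tauCurve (s.pt τ)).lattice) :
    s.d * z ∈ (tauCurve τ).lattice := by
  obtain ⟨m, n, rfl⟩ := mem_tauCurve.mp hz
  refine mem_tauCurve.mpr ⟨m * s.a, m * s.b + n * s.d, ?_⟩
  have := s.d_ne_zero
  rw [s.coe_pt]
  push_cast
  field_simp
  ring

/-- The isogeny `E_{(aτ + b)/d} → E_τ` given by multiplication by `d`. -/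
def isog : Isogeny (tauCurve (s.pt τ)) (tauCurve τ) :=
  Isogeny.ofMul s.d s.d_ne_zero fun _ hz => s.mul_mem_tauCurve τ hz

/-- The kernel of the isogeny attached to a Hermite form is cyclic of order `N`. -/
theorem exists_ker_isog_eq : ∃ κ : (tauCurve (s.pt τ)).Points,
    (s.isog τ).hom.ker = AddSubgroup.zmultiples κ ∧ addOrderOf κ = N := by
  obtain ⟨A, B, x, y, hxy, hAB⟩ := s.exists_linear_form
  have hd := s.d_ne_zero
  have hmem : ∀ u v : ℤ, (tauCurve (s.pt τ)).proj (((u : ℂ) * τ + v) / s.d) = 0 ↔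
      (N : ℤ) ∣ A * u + B * v := fun u v => by
    rw [hAB, ← s.mem_tauCurve_pt τ, EllCurve.proj_eq_zero]
  have hmul : ∀ k : ℤ, k • (tauCurve (s.pt τ)).proj (((x : ℂ) * τ + y) / s.d)
      = (tauCurve (s.pt τ)).proj ((((k * x : ℤ) : ℂ) * τ + (k * y : ℤ)) / s.d) := fun k => by
    rw [EllCurve.zsmul_proj]
    congr 1
    push_cast
    ring
  refine ⟨(tauCurve (s.pt τ)).proj (((x : ℂ) * τ + y) / s.d), le_antisymm ?_ ?_, ?_⟩
  · intro P hP
    obtain ⟨z, rfl⟩ := (tauCurve (s.pt τ)).proj_surjective P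
    have hz : (tauCurve τ).proj (s.d * z) = 0 := hP
    obtain ⟨u, v, huv⟩ := mem_tauCurve.mp ((tauCurve τ).proj_eq_zero.mp hz)
    obtain rfl : z = ((u : ℂ) * τ + v) / s.d := by rw [eq_div_iff hd, huv, mul_comm]
    refine AddSubgroup.mem_zmultiples_iff.mpr ⟨A * u + B * v, ?_⟩
    rw [hmul, ← sub_eq_zero]
    change (tauCurve (s.pt τ)).proj (_ - _) = 0
    have e : ((((A * u + B * v) * x : ℤ) : ℂ) * τ + ((A * u + B * v) * y : ℤ)) / s.d
        - ((u : ℂ) * τ + v) / s.d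
        = ((((A * u + B * v) * x - u : ℤ) : ℂ) * τ + ((A * u + B * v) * y - v : ℤ)) / s.d := by
      push_cast
      ring
    rw [e, hmem]
    exact ⟨0, by linear_combination (A * u + B * v) * hxy⟩
  · refine AddSubgroup.zmultiples_le_of_mem ?_
    change (tauCurve τ).proj (s.d * (((x : ℂ) * τ + y) / s.d)) = 0
    rw [mul_div_cancel₀ _ hd, EllCurve.proj_eq_zero]
    exact mem_tauCurve.mpr ⟨x, y, rfl⟩
  · have key : ∀ k : ℕ, k • (tauCurve (s.pt τ)).proj (((x : ℂ) * τ + y) / s.d) = 0 ↔ N ∣ k := by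
      intro k
      rw [← natCast_zsmul, hmul, hmem]
      have e : A * (k * x) + B * (k * y) = (k : ℤ) := by linear_combination (k : ℤ) * hxy
      rw [e, Int.natCast_dvd_natCast]
    exact Nat.dvd_antisymm (addOrderOf_dvd_of_nsmul_eq_zero ((key N).2 dvd_rfl))
      ((key _).1 (addOrderOf_nsmul_eq_zero _))

theorem card_ker_isog : Nat.card (s.isog τ).hom.ker = N := by
  obtain ⟨κ, h, hκ⟩ := s.exists_ker_isog_eq τ
  rw [h, Nat.card_zmultiples, hκ]

theorem isCyclic_isog : (s.isog τ).IsCyclic := by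
  obtain ⟨κ, h, -⟩ := s.exists_ker_isog_eq τ
  rw [Isogeny.IsCyclic, h]
  infer_instance

theorem map_isog [NeZero M] (hMN : Nat.Coprime M N) :
    (tauLevel M (s.pt τ)).C.map (s.isog τ).hom = (tauLevel M τ).C := by
  change (AddSubgroup.zmultiples ((tauCurve (s.pt τ)).proj (1 / M : ℂ))).map (s.isog τ).hom
    = AddSubgroup.zmultiples ((tauCurve τ).proj (1 / M : ℂ))
  rw [AddMonoidHom.map_zmultiples]
  change AddSubgroup.zmultiples ((tauCurve τ).proj (s.d * (1 / M : ℂ))) = _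
  rw [← EllCurve.zsmul_proj]
  apply zmultiples_zsmul_eq
  rw [addOrderOf_inv]
  exact s.isCoprime_d hMN

variable {τ} {X : LevelCurve M}

/-- The cyclic isogeny to `(E, C) ≅ (E_τ, ⟨1/M⟩)` attached to a Hermite form. -/
def cycIsog [NeZero M] (hMN : Nat.Coprime M N) (g : Isogeny (tauCurve τ) X.E) (hg : g.IsIso)
    (hC : (tauLevel M τ).C.map g.hom = X.C) : CycIsog M N X where
  source := tauLevel M (s.pt τ)
  f := g.comp (s.isog τ)
  degree_eq := by
    change Nat.card (g.comp (s.isog τ)).hom.ker = N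
    rw [Isogeny.ker_comp g hg, s.card_ker_isog]
  cyclic := by
    change IsAddCyclic (g.comp (s.isog τ)).hom.ker
    rw [Isogeny.ker_comp g hg]
    exact s.isCyclic_isog τ
  map_C := by
    refine Eq.trans ?_ hC
    rw [← s.map_isog τ hMN]
    exact (AddSubgroup.map_map _ g.hom (s.isog τ).hom).symm

/-- Inequivalent Hermite forms define inequivalent isogenies, as the form can be read off from the
sublattice `ℤ (aτ + b) + ℤ d` of `ℤ τ + ℤ`. -/
theorem cycIsog_injective [NeZero M] (hMN : Nat.Coprime M N) (g : Isogeny (tauCurve τ) X.E)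
    (hg : g.IsIso) (hC : (tauLevel M τ).C.map g.hom = X.C) :
    Function.Injective fun s : HermiteForm N =>
      (Quotient.mk (cycIsogSetoid M N X) (s.cycIsog hMN g hg hC)) := by
  intro s s' h
  obtain ⟨j, hj, hf, -⟩ := Quotient.exact h
  obtain ⟨β, hβ, hjmul⟩ := j.exists_mul
  have hdβ : (s.d : ℂ) = s'.d * β := by
    refine (tauCurve τ).eq_of_forall_proj_eq fun z => hg.1 ?_
    have h1 := DFunLike.congr_fun hf ((tauCurve (s.pt τ)).proj z)
    have h2 : (s'.cycIsog hMN g hg hC).f.hom (j.hom ((tauCurve (s.pt τ)).proj z))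
        = g.hom ((tauCurve τ).proj (s'.d * (β * z))) :=
      congrArg (s'.cycIsog hMN g hg hC).f.hom (hjmul z)
    rw [mul_assoc, ← h2]
    exact h1
  have hlat : ∀ z, z ∈ (tauCurve (s.pt τ)).lattice ↔ β * z ∈ (tauCurve (s'.pt τ)).lattice :=
    fun z => ⟨Isogeny.mul_mem_lattice hjmul, (Isogeny.isIso_iff hβ hjmul).mp hj z⟩
  have hlat' : ∀ u v : ℤ, (∃ m n : ℤ, u = m * s.a ∧ v = m * s.b + n * s.d) ↔
      ∃ m n : ℤ, u = m * s'.a ∧ v = m * s'.b + n * s'.d := fun u v => by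
    rw [← s.mem_tauCurve_pt τ, ← s'.mem_tauCurve_pt τ, hlat]
    have hd := s.d_ne_zero
    have hd' := s'.d_ne_zero
    have e : β * (((u : ℂ) * τ + v) / s.d) = ((u : ℂ) * τ + v) / s'.d := by
      rw [hdβ]
      field_simp
    rw [e]
  obtain ⟨m₁, n₁, h1, h1'⟩ := (hlat' s.a s.b).mp ⟨1, 0, by ring, by ring⟩
  obtain ⟨m₂, n₂, h2, h2'⟩ := (hlat' 0 s.d).mp ⟨0, 1, by ring, by ring⟩
  obtain ⟨m₃, n₃, h3, h3'⟩ := (hlat' s'.a s'.b).mpr ⟨1, 0, by ring, by ring⟩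
  have ha : s.a = s'.a :=
    Int.dvd_antisymm s.a_pos.le s'.a_pos.le ⟨m₃, by rw [h3, mul_comm]⟩ ⟨m₁, by rw [h1, mul_comm]⟩
  have hd : s.d = s'.d := by
    have := s.mul_eq.trans s'.mul_eq.symm
    rw [ha] at this
    exact mul_left_cancel₀ s'.a_pos.ne' this
  have hm1 : m₁ = 1 := by
    apply mul_right_cancel₀ s'.a_pos.ne'
    rw [← h1, ha, one_mul]
  have hb : s.b = s'.b := by
    rw [← Int.emod_eq_of_lt s.b_nonneg s.b_lt, ← Int.emod_eq_of_lt s'.b_nonneg s'.b_lt, hd, h1',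
      hm1]
    simp
  exact HermiteForm.ext ha hb hd

/-- Every cyclic isogeny of degree `N` is equivalent to the one attached to a Hermite form. -/
theorem cycIsog_surjective [NeZero M] (hN : 0 < N) (hMN : Nat.Coprime M N)
    (g : Isogeny (tauCurve τ) X.E) (hg : g.IsIso) (hC : (tauLevel M τ).C.map g.hom = X.C) :
    Function.Surjective fun s : HermiteForm N =>
      (Quotient.mk (cycIsogSetoid M N X) (s.cycIsog hMN g hg hC)) := by
  intro c
  obtain ⟨φ, rfl⟩ := Quotient.exists_rep c
  obtain ⟨α, hα, hfmul⟩ := φ.f.exists_mul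
  obtain ⟨β, hβ, hgmul⟩ := g.exists_mul
  -- Multiplication by `δ` is the composite `E₁ → E → E_τ`.
  set δ : ℂ := β⁻¹ * α with hδ
  have hδ0 : δ ≠ 0 := mul_ne_zero (inv_ne_zero hβ) hα
  have hβδ : ∀ z, β * (δ * z) = α * z := fun z => by
    rw [hδ, mul_assoc, mul_inv_cancel_left₀ hβ]
  have hker : ∀ z, φ.source.E.proj z ∈ φ.f.hom.ker ↔ δ * z ∈ (tauCurve τ).lattice := fun z => by
    rw [AddMonoidHom.mem_ker, hfmul, EllCurve.proj_eq_zero, ← hβδ]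
    exact ⟨(Isogeny.isIso_iff hβ hgmul).mp hg _, Isogeny.mul_mem_lattice hgmul⟩
  have hcard : Nat.card φ.f.hom.ker = N := φ.degree_eq
  obtain ⟨⟨κ, hκm⟩, hκ⟩ := φ.cyclic.exists_generator
  have hκ' : ∀ P ∈ φ.f.hom.ker, ∃ k : ℤ, k • κ = P := fun P hP => by
    obtain ⟨k, hk⟩ := hκ ⟨P, hP⟩
    exact ⟨k, congrArg Subtype.val hk⟩
  have hord : addOrderOf κ = N := by
    have e : φ.f.hom.ker = AddSubgroup.zmultiples κ :=
      le_antisymm (fun P hP => hκ' P hP) (AddSubgroup.zmultiples_le_of_mem hκm)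
    rw [← Nat.card_zmultiples, ← e, hcard]
  have hmemker : ∀ u v : ℤ, φ.source.E.proj (((u : ℂ) * τ + v) / δ) ∈ φ.f.hom.ker := fun u v => by
    rw [hker, mul_div_cancel₀ _ hδ0]
    exact mem_tauCurve.mpr ⟨u, v, rfl⟩
  obtain ⟨A, hA⟩ := hκ' _ (hmemker 1 0)
  obtain ⟨B, hB⟩ := hκ' _ (hmemker 0 1)
  have hlin : ∀ u v : ℤ, φ.source.E.proj (((u : ℂ) * τ + v) / δ) = (A * u + B * v) • κ := by
    intro u v
    rw [add_smul, mul_comm A, mul_comm B, mul_smul, mul_smul, hA, hB, EllCurve.zsmul_proj,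
      EllCurve.zsmul_proj, ← EllCurve.proj_add]
    congr 1
    push_cast
    ring
  have hzero : ∀ u v : ℤ, ((u : ℂ) * τ + v) / δ ∈ φ.source.E.lattice ↔ (N : ℤ) ∣ A * u + B * v :=
    fun u v => by
    rw [← EllCurve.proj_eq_zero, hlin, ← addOrderOf_dvd_iff_zsmul_eq_zero, hord]
  have hprim : ∃ x y z : ℤ, A * x + B * y + N * z = 1 := by
    obtain ⟨w, rfl⟩ := φ.source.E.proj_surjective κ
    obtain ⟨x, y, hxy⟩ := mem_tauCurve.mp ((hker w).mp hκm)
    have hw : w = ((x : ℂ) * τ + y) / δ := by rw [hxy, mul_div_cancel_left₀ _ hδ0]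
    have h1 : (A * x + B * y - 1) • φ.source.E.proj w = 0 := by
      rw [sub_smul, ← hlin, one_smul, ← hw, sub_self]
    rw [← addOrderOf_dvd_iff_zsmul_eq_zero, hord] at h1
    obtain ⟨z, hz⟩ := h1
    exact ⟨x, y, -z, by linear_combination hz⟩
  obtain ⟨s, hs⟩ := exists_dvd_iff hN A B hprim
  refine ⟨s, Quotient.sound (Setoid.symm ?_)⟩
  have hd := s.d_ne_zero
  -- Multiplication by `δ / d` identifies the source of the given isogeny with `E_{(aτ + b)/d}`.
  have hlat : ∀ z, z ∈ φ.source.E.lattice ↔ δ / s.d * z ∈ (tauCurve (s.pt τ)).lattice := by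
    have key : ∀ u v : ℤ, ((u : ℂ) * τ + v) / δ ∈ φ.source.E.lattice ↔
        ((u : ℂ) * τ + v) / s.d ∈ (tauCurve (s.pt τ)).lattice := fun u v => by
      rw [hzero, hs, s.mem_tauCurve_pt]
    intro z
    by_cases hz : δ * z ∈ (tauCurve τ).lattice
    · obtain ⟨u, v, huv⟩ := mem_tauCurve.mp hz
      have h1 : z = ((u : ℂ) * τ + v) / δ := by rw [huv, mul_div_cancel_left₀ _ hδ0]
      have h2 : δ / s.d * z = ((u : ℂ) * τ + v) / s.d := by rw [huv]; ring
      rw [h2, ← key, ← h1]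
    · refine iff_of_false (fun h => hz ?_) (fun h => hz ?_)
      · rw [← hker, EllCurve.proj_eq_zero _ |>.mpr h]
        exact zero_mem _
      · have := s.mul_mem_tauCurve τ h
        rwa [← mul_assoc, mul_div_cancel₀ _ hd] at this
  have hδd : δ / s.d ≠ 0 := div_ne_zero hδ0 hd
  let j : Isogeny φ.source.E (s.cycIsog hMN g hg hC).source.E :=
    Isogeny.ofMul (δ / s.d) hδd fun z hz => (hlat z).mp hz
  have hj : j.IsIso := (Isogeny.isIso_iff hδd fun _ => rfl).mpr fun z hz => (hlat z).mpr hz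
  have hcomp : φ.f.hom = (s.cycIsog hMN g hg hC).f.hom.comp j.hom := by
    ext P
    obtain ⟨z, rfl⟩ := φ.source.E.proj_surjective P
    rw [hfmul]
    change _ = g.hom ((tauCurve τ).proj (s.d * (δ / s.d * z)))
    rw [hgmul, ← mul_assoc (s.d : ℂ), mul_div_cancel₀ _ hd, hβδ]
  refine ⟨j, hj, hcomp, ?_⟩
  -- Both subgroups have order `M` and the same image in `E`.
  have himg : (φ.source.C.map j.hom).map (s.cycIsog hMN g hg hC).f.hom
      = (s.cycIsog hMN g hg hC).source.C.map (s.cycIsog hMN g hg hC).f.hom := by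
    rw [AddSubgroup.map_map, ← hcomp, φ.map_C, (s.cycIsog hMN g hg hC).map_C]
  have hcardj : Nat.card (φ.source.C.map j.hom) = M :=
    (Nat.card_congr (φ.source.C.equivMapOfInjective j.hom hj.1).toEquiv).symm.trans φ.source.card
  have hcards := (s.cycIsog hMN g hg hC).source.card
  have hdeg := (s.cycIsog hMN g hg hC).degree_eq
  exact le_antisymm (le_of_map_le_map _ hMN hdeg hcardj hcards himg.le)
    (le_of_map_le_map _ hMN hdeg hcards hcardj himg.ge)

end HermiteForm

/-- The product over the classes of cyclic isogenies to `(E_τ, ⟨1/M⟩)` in terms of the conjugates of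
the Hauptmodul. -/
theorem finprod_sourceValue [NeZero M] {t : ℍ → ℂ} (hN : 0 < N) (hMN : Nat.Coprime M N)
    (ht : ∀ γ ∈ CongruenceSubgroup.Gamma0 M, ∀ τ : ℍ, t (γ • τ) = t τ)
    {X : LevelCurve M} {τ : ℍ} (h : X.Iso (tauLevel M τ)) (x : ℂ) :
    ∏ᶠ c : CycIsogClass M N X, (x - sourceValue M N t X c)
      = ∏ s : HermiteForm N, (x - t (s.pt τ)) := by
  obtain ⟨g, hg, hC⟩ := h.symm
  rw [← finprod_eq_prod_of_fintype]
  symm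
  refine finprod_eq_of_bijective (fun s : HermiteForm N => Quotient.mk _ (s.cycIsog hMN g hg hC))
    ⟨HermiteForm.cycIsog_injective hMN g hg hC, HermiteForm.cycIsog_surjective hN hMN g hg hC⟩
    fun s => ?_
  change _ = x - value M t (tauLevel M (s.pt τ))
  rw [value_tauLevel ht]

end Classification

/-! ### The modular polynomial -/

section ModularPolynomial

open Polynomial

variable {M N : ℕ} {t : ℍ → ℂ}

/-- The polynomial `∏ (X - t((aτ + b)/d))` over the ring of functions on the upper half plane. -/
def conjPolynomial (N : ℕ) (t : ℍ → ℂ) : (ℍ → ℂ)[X] :=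
  ∏ s : HermiteForm N, (X - C fun τ => t (s.pt τ))

theorem monic_conjPolynomial : (conjPolynomial N t).Monic :=
  monic_prod_of_monic _ _ fun _ _ => monic_X_sub_C _

theorem natDegree_conjPolynomial :
    (conjPolynomial N t).natDegree = Fintype.card (HermiteForm N) := by
  rw [conjPolynomial, natDegree_prod_of_monic _ _ fun _ _ => monic_X_sub_C _]
  simp

theorem map_evalRingHom_conjPolynomial (τ : ℍ) :
    (conjPolynomial N t).map (Pi.evalRingHom (fun _ : ℍ => ℂ) τ)
      = ∏ s : HermiteForm N, (X - C (t (s.pt τ))) := by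
  simp [conjPolynomial, Polynomial.map_prod]

/-- The coefficients of `∏ (X - t((aτ + b)/d))` are `Γ₀(M)`-invariant, hence polynomials in `t`. -/
theorem IsHauptmodul.conjPolynomial_mem_lifts [NeZero M] (ht : IsHauptmodul M t) (hN : 0 < N)
    (hMN : Nat.Coprime M N) :
    conjPolynomial N t ∈ lifts (aeval (R := ℂ) t).toRingHom := by
  rw [lifts_iff_coeff_lifts]
  intro n
  refine ht.exists_aeval_eq ?_ fun γ hγ τ => ?_
  · let Q : (poleAtInftySubalgebra M)[X] :=
      ∏ s : HermiteForm N, (X - C ⟨fun τ => t (s.pt τ), ht.comp_pt_mem hN hMN s⟩)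
    have hQ : conjPolynomial N t = Q.map (poleAtInftySubalgebra M).val.toRingHom := by
      simp [conjPolynomial, Q, Polynomial.map_prod]
    rw [hQ, coeff_map]
    exact (Q.coeff n).2
  · obtain ⟨σ, hσ⟩ := ht.exists_perm (N := N) hN hMN hγ
    have key : (conjPolynomial N t).map (Pi.evalRingHom (fun _ : ℍ => ℂ) (γ • τ))
        = (conjPolynomial N t).map (Pi.evalRingHom (fun _ : ℍ => ℂ) τ) := by
      rw [map_evalRingHom_conjPolynomial, map_evalRingHom_conjPolynomial]
      simp only [hσ]
      exact Equiv.prod_comp σ fun s => X - C (t (s.pt τ))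
    have := congrArg (fun p => p.coeff n) key
    simp only [coeff_map] at this
    exact this

theorem map_eval_of_map_aeval {Φ : ℂ[X][X]}
    (hΦ : Φ.map (aeval (R := ℂ) t).toRingHom = conjPolynomial N t) (τ : ℍ) :
    Φ.map (evalRingHom (t τ)) = ∏ s : HermiteForm N, (X - C (t (s.pt τ))) := by
  rw [← map_evalRingHom_conjPolynomial, ← hΦ, Polynomial.map_map]
  congr 1
  ext <;> simp

theorem evalEval_eq_eval_map {R : Type*} [CommSemiring R] (x y : R) (A : R[X][X]) :
    A.evalEval y x = (A.map (evalRingHom y)).eval x := by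
  rw [← eval₂_evalRingHom, eval_map]

theorem evalEval_of_map_aeval {Φ : ℂ[X][X]}
    (hΦ : Φ.map (aeval (R := ℂ) t).toRingHom = conjPolynomial N t) (x : ℂ) (τ : ℍ) :
    Φ.evalEval (t τ) x = ∏ s : HermiteForm N, (x - t (s.pt τ)) := by
  rw [evalEval_eq_eval_map, map_eval_of_map_aeval hΦ]
  simp [eval_prod]

theorem isCyclicModularPolynomial_of_map_aeval [NeZero M] (ht : IsHauptmodul M t) (hN : 0 < N)
    (hMN : Nat.Coprime M N) {Φ : ℂ[X][X]}
    (hΦ : Φ.map (aeval (R := ℂ) t).toRingHom = conjPolynomial N t) :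
    IsCyclicModularPolynomial M N t Φ := by
  intro X₁ X₂
  obtain ⟨τ, hτ⟩ := X₂.exists_iso_tauLevel
  have h2 : value M t X₂ = t τ := by
    rw [value_eq_of_iso t hτ, value_tauLevel ht.invariant]
  rw [finprod_sourceValue hN hMN ht.invariant hτ, h2, evalEval_of_map_aeval hΦ]

/-- A Hauptmodul takes infinitely many values, as it is unbounded at `∞`. -/
theorem IsHauptmodul.infinite_range (ht : IsHauptmodul M t) : (Set.range t).Infinite := by
  intro hfin
  obtain ⟨B, hB⟩ := hfin.isBounded.exists_norm_le
  have h0 : Filter.Tendsto (fun τ : ℍ => Function.Periodic.qParam 1 τ * t τ)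
      UpperHalfPlane.atImInfty (nhds 0) := by
    refine (UpperHalfPlane.qParam_tendsto_atImInfty one_pos).zero_mul_isBoundedUnder_le ?_
    exact Filter.isBoundedUnder_of ⟨B, fun τ => hB _ ⟨τ, rfl⟩⟩
  exact one_ne_zero (tendsto_nhds_unique ht.simple_pole h0)

theorem IsHauptmodul.eq_of_isCyclicModularPolynomial [NeZero M] (ht : IsHauptmodul M t)
    {Φ Ψ : ℂ[X][X]} (hΦ : IsCyclicModularPolynomial M N t Φ)
    (hΨ : IsCyclicModularPolynomial M N t Ψ) : Φ = Ψ := by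
  have h : ∀ x ∈ Set.range t, ∀ y ∈ Set.range t, Φ.evalEval y x = Ψ.evalEval y x := by
    rintro _ ⟨τ, rfl⟩ _ ⟨τ', rfl⟩
    have h1 := hΦ (tauLevel M τ) (tauLevel M τ')
    have h2 := hΨ (tauLevel M τ) (tauLevel M τ')
    rw [value_tauLevel ht.invariant, value_tauLevel ht.invariant] at h1 h2
    rw [h1, h2]
  have hmap : ∀ y ∈ Set.range t, Φ.map (evalRingHom y) = Ψ.map (evalRingHom y) := fun y hy => by
    refine eq_of_infinite_eval_eq _ _ (ht.infinite_range.mono fun x hx => ?_)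
    change eval x _ = eval x _
    rw [← evalEval_eq_eval_map, ← evalEval_eq_eval_map, h x hx y hy]
  ext1 n
  refine eq_of_infinite_eval_eq _ _ (ht.infinite_range.mono fun y hy => ?_)
  have := congrArg (fun p => p.coeff n) (hmap y hy)
  simp only [coeff_map] at this
  exact this

theorem mdifferentiable_evalEval {f g : ℍ → ℂ} (hf : MDiff f) (hg : MDiff g) (A : ℂ[X][X]) :
    MDiff (fun τ => A.evalEval (f τ) (g τ)) := by
  induction A using Polynomial.induction_on' with
  | add p q hp hq =>
    simp only [evalEval_add]
    exact hp.add hq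
  | monomial n p =>
    have h1 : MDiff (fun τ => p.eval (f τ)) := p.differentiable.mdifferentiable.comp hf
    have h2 : MDiff (fun τ => g τ ^ n) :=
      (differentiable_pow (𝕜 := ℂ) n).mdifferentiable.comp hg
    simp only [evalEval_eq_eval_map, map_monomial, eval_monomial, coe_evalRingHom]
    exact h1.mul h2

/-- At a suitable point of the upper half plane all conjugates of the Hauptmodul take different
values. -/
theorem IsHauptmodul.exists_injective (ht : IsHauptmodul M t) (N : ℕ) :
    ∃ τ : ℍ, Function.Injective fun s : HermiteForm N => t (s.pt τ) := by
  by_contra! hcon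
  have h0 : ∏ i ∈ (Finset.univ : Finset (HermiteForm N)).offDiag,
      ((fun τ => t (i.1.pt τ)) - fun τ => t (i.2.pt τ) : ℍ → ℂ) = 0 := by
    ext τ
    obtain ⟨s, s', h, hne⟩ := Function.not_injective_iff.mp (hcon τ)
    rw [Finset.prod_apply]
    exact Finset.prod_eq_zero (i := (s, s')) (by simpa using hne) (sub_eq_zero.mpr h)
  obtain ⟨i, hi, h⟩ := (UpperHalfPlane.prod_eq_zero_iff fun i _ =>
    (i.1.mdifferentiable_comp_pt ht.holo).sub (i.2.mdifferentiable_comp_pt ht.holo)).mp h0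
  rw [Finset.mem_offDiag] at hi
  exact hi.2.2 (ht.eq_of_comp_pt_eq (sub_eq_zero.mp h))

/-- A relation over `ℂ[t]` satisfied by `t(N τ)` is satisfied by all the conjugates, by transitivity
of `Γ₀(M)`; since they are distinct, this bounds its degree from below. -/
theorem IsHauptmodul.card_le_natDegree (ht : IsHauptmodul M t) (hN : 0 < N)
    (hMN : Nat.Coprime M N) {A : ℂ[X][X]} (hA : A.Monic)
    (h : (fun τ => A.evalEval (t τ) (t ((HermiteForm.diag N hN).pt τ))) = 0) :
    Fintype.card (HermiteForm N) ≤ A.natDegree := by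
  obtain ⟨τ, hτ⟩ := ht.exists_injective N
  have hroot : ∀ s : HermiteForm N, A.evalEval (t τ) (t (s.pt τ)) = 0 := by
    intro s
    obtain ⟨γ, hγ, hs⟩ := ht.exists_comp_pt_diag hN hMN s
    have := congrFun h (γ • τ)
    simp only [ht.invariant γ hγ, hs] at this
    exact this
  have hm : (A.map (evalRingHom (t τ))).Monic := hA.map _
  rw [← hA.natDegree_map (evalRingHom (t τ)), ← Finset.card_univ,
    ← Finset.card_image_of_injective _ hτ]
  refine card_le_degree_of_subset_roots fun x hx => ?_
  obtain ⟨s, -, rfl⟩ := Finset.mem_image.mp hx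
  rw [mem_roots hm.ne_zero, IsRoot, ← evalEval_eq_eval_map]
  exact hroot s

theorem IsHauptmodul.irreducible_of_map_aeval (ht : IsHauptmodul M t) (hN : 0 < N)
    (hMN : Nat.Coprime M N) {Φ : ℂ[X][X]} (hm : Φ.Monic)
    (hΦ : Φ.map (aeval (R := ℂ) t).toRingHom = conjPolynomial N t) : Irreducible Φ := by
  have hdeg : Φ.natDegree = Fintype.card (HermiteForm N) := by
    rw [← natDegree_conjPolynomial (t := t), ← hΦ, hm.natDegree_map]
  have hpos : 0 < Fintype.card (HermiteForm N) :=
    Fintype.card_pos_iff.mpr ⟨HermiteForm.diag N hN⟩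
  refine hm.irreducible_iff_natDegree.mpr ⟨?_, fun A B hA hB hAB => ?_⟩
  · rintro rfl
    rw [natDegree_one] at hdeg
    exact hpos.ne hdeg
  have hsum : A.natDegree + B.natDegree = Fintype.card (HermiteForm N) := by
    rw [← hdeg, ← hAB, hA.natDegree_mul hB]
  have ht₀ := (HermiteForm.diag N hN).mdifferentiable_comp_pt ht.holo
  have hzero : (fun τ => A.evalEval (t τ) (t ((HermiteForm.diag N hN).pt τ))) *
      (fun τ => B.evalEval (t τ) (t ((HermiteForm.diag N hN).pt τ))) = 0 := by
    ext τ
    rw [Pi.mul_apply, ← evalEval_mul, hAB, evalEval_of_map_aeval hΦ]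
    exact Finset.prod_eq_zero (Finset.mem_univ (HermiteForm.diag N hN)) (sub_self _)
  rcases (UpperHalfPlane.mul_eq_zero_iff (mdifferentiable_evalEval ht.holo ht₀ A)
    (mdifferentiable_evalEval ht.holo ht₀ B)).mp hzero with h | h
  · have := ht.card_le_natDegree hN hMN hA h
    right
    omega
  · have := ht.card_le_natDegree hN hMN hB h
    left
    omega

end ModularPolynomial

end CyclicModular
end

theorem mainTheorem4 (M N : ℕ) [NeZero M] (hN : 0 < N) (hMN : Nat.Coprime M N)
    (t : ℍ → ℂ) (ht : CyclicModular.IsHauptmodul M t) :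
    (∃! Ψ : ℂ[X][X], CyclicModular.IsCyclicModularPolynomial M N t Ψ) ∧
    ∀ Ψ : ℂ[X][X], CyclicModular.IsCyclicModularPolynomial M N t Ψ →
      Irreducible (Ψ.map (algebraMap ℂ[X] (RatFunc ℂ))) := by
  obtain ⟨Φ, hΦ, -, hm⟩ := Polynomial.lifts_and_natDegree_eq_and_monic
    (ht.conjPolynomial_mem_lifts hN hMN) CyclicModular.monic_conjPolynomial
  have hΦP := CyclicModular.isCyclicModularPolynomial_of_map_aeval ht hN hMN hΦ
  refine ⟨⟨Φ, hΦP, fun Ψ hΨ => ht.eq_of_isCyclicModularPolynomial hΨ hΦP⟩, fun Ψ hΨ => ?_⟩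
  rw [ht.eq_of_isCyclicModularPolynomial hΨ hΦP]
  exact (hm.irreducible_iff_irreducible_map_fraction_map (K := RatFunc ℂ)).mp
    (ht.irreducible_of_map_aeval hN hMN hm hΦ)
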